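/- Let $M$ be a one-cusped hyperbolic 3-manifold, i.e. a compact connected 3-manifold with boundary a single torus whose interior is homeomorphic to a finite-volume quotient $\mathbb H^3/\Gamma$ by a discrete group of orientation-preserving isometries acting freely. Let $X(M)$ be its $SL_2(\mathbb C)$-character variety and let $C\subset X(M)$ be a norm curve: a one-dimensional irreducible component on which the trace of every nontrivial element of $\pi_1(\partial M)$ is nonconstant. Let $D$ be an irreducible curve in the representation variety $\mathrm{Hom}(\pi_1(M),SL_2(\mathbb C))$ that the trace map sends dominantly to $C$, so that $k(C)\subset k(D)$ for the function fields over $\mathbb C$. Let $P\colon\pi_1(M)\to SL_2(k(D))$ be the tautological representation, whose $ij$ entry at $g$ is the function $\rho\mapsto\rho(g)_{ij}$, and let $A_{k(C)}=\{\sum_i\alpha_iP(\gamma_i)\mid\alpha_i\in k(C),\ \gamma_i\in\pi_1(M)\}$. Let $x$ be an ideal point of $C$, i.e. a point of the smooth projective model of $C$ at which some regular function on $C$ has a pole, with local ring $\mathcal O_x\subset k(C)$, and let $\tilde x$ be a point of the smooth projective model of $D$ lying over $x$, with local ring $\mathcal O_{\tilde x}\subset k(D)$. Let $S\subset M$ be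 an essential surface (compact, properly embedded, possibly disconnected, two-sided, $\pi_1$-injective, with no boundary-parallel component) detected by $x$: there is a continuous $\pi_1(M)$-equivariant map from the universal cover of $M$ to the Bass-Serre tree of $SL_2(k(D))$ for $\mathcal O_{\tilde x}$, with $\pi_1(M)$ acting on the tree through $P$, that is transverse to the midpoints of the edges and for which the inverse image of the set of midpoints is the preimage of $S$, where components of $S$ may be replaced by several parallel copies of themselves. Let $M'$ be a component of $M\setminus S$, and let $\chi_\infty$ be the limiting character on $\pi_1(M')$: $\chi_\infty(g)$ is obtained by conjugating $P(g)$ by an element of $GL_2(k(D))$ into $SL_2(\mathcal O_{\tilde x})$, reducing modulo the maximal ideal of $\mathcal O_{\tilde x}$, and taking the trace. Suppose that $\chi_\infty$ is the trace of an irreducible representation $\rho_\infty\colon\pi_1(M')\to SL_2(\mathbb C)$. Then $A_{k(C)}$ tautologically extends over $x$: there are $g,h\in\pi_1(M)$ such that the $\mathcal O_x$-span $A_x$ of $\{1,P(g),P(h),P(gh)\}$ is an Azumaya algebra over $\mathcal O_x$ with $A_x\otimes_{\mathcal O_x}k(C)\cong A_{k(C)}$. Concretely, there are $g,h\in\pi_1(M')$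 such that the restriction of $\rho_\infty$ to $\langle g,h\rangle$ is irreducible; and all $g,h\in\pi_1(M')$ with this property are noncommuting and have the property that the $\mathcal O_x$-span of $\{1,P(g),P(h),P(gh)\}$ is an Azumaya algebra over $\mathcal O_x$ whose base change to $k(C)$ is isomorphic to $A_{k(C)}$. -/

import Mathlib

open scoped Manifold ContDiff TensorProduct

noncomputable section

namespace CullerShalen

/-! ### Affine curves over `ℂ`

An affine algebraic set is handled through its set of points `Y` and its algebra `A` of regular
functions. -/

section Curves

/-- The Zariski topology on `Y` for which the sets `{f ≠ 0}`, with `f` regular, are basic open. -/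
abbrev zariskiTopology {Y : Type*} (A : Subalgebra ℂ (Y → ℂ)) : TopologicalSpace Y :=
  TopologicalSpace.generateFrom {U | ∃ f ∈ A, U = {y | f y ≠ 0}}

/-- Restriction of functions from `Y` to a subset `Z`. -/
def restrictFun {Y : Type*} (Z : Set Y) : (Y → ℂ) →ₐ[ℂ] (Z → ℂ) where
  toFun f := fun z => f z
  map_one' := rfl
  map_mul' _ _ := rfl
  map_zero' := rfl
  map_add' _ _ := rfl
  commutes' _ := rfl

/-- An irreducible Zariski closed subset of dimension one. -/
structure AlgCurve {Y : Type*} (A : Subalgebra ℂ (Y → ℂ)) where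
  carrier : Set Y
  isClosed : @IsClosed Y (zariskiTopology A) carrier
  isIrreducible : @IsIrreducible Y (zariskiTopology A) carrier
  dim_eq_one :
    @topologicalKrullDim carrier (@instTopologicalSpaceSubtype Y (· ∈ carrier) (zariskiTopology A))
      = 1

variable {Y : Type*} {A : Subalgebra ℂ (Y → ℂ)}

/-- The ring `ℂ[C]` of regular functions on the affine curve `C`. -/
def AlgCurve.coordRing (C : AlgCurve A) : Subalgebra ℂ (C.carrier → ℂ) :=
  A.map (restrictFun C.carrier)

theorem isOpen_ne_zero {f : Y → ℂ} (hf : f ∈ A) :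
    @IsOpen Y (zariskiTopology A) {y | f y ≠ 0} :=
  TopologicalSpace.isOpen_generateFrom_of_mem ⟨f, hf, rfl⟩

instance AlgCurve.isDomain (C : AlgCurve A) : IsDomain C.coordRing := by
  have hne : C.carrier.Nonempty := C.isIrreducible.1
  have : Nonempty C.carrier := hne.to_subtype
  have hnt : Nontrivial C.coordRing := inferInstance
  have hnzd : NoZeroDivisors C.coordRing := by
    refine ⟨fun {a b} hab => ?_⟩
    by_contra hcon
    push Not at hcon
    obtain ⟨ha, hb⟩ := hcon
    obtain ⟨_, f, hf, rfl⟩ := a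
    obtain ⟨_, g, hg, rfl⟩ := b
    have h1 : ∃ y ∈ C.carrier, f y ≠ 0 := by
      by_contra h
      push Not at h
      exact ha (Subtype.ext (funext fun z => h z z.2))
    have h2 : ∃ y ∈ C.carrier, g y ≠ 0 := by
      by_contra h
      push Not at h
      exact hb (Subtype.ext (funext fun z => h z z.2))
    obtain ⟨y1, hy1, hf1⟩ := h1
    obtain ⟨y2, hy2, hg2⟩ := h2
    obtain ⟨y, hy, hfy, hgy⟩ := C.isIrreducible.2 _ _ (isOpen_ne_zero hf) (isOpen_ne_zero hg)
      ⟨y1, hy1, hf1⟩ ⟨y2, hy2, hg2⟩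
    have := congrFun (congrArg Subtype.val hab) ⟨y, hy⟩
    exact (mul_ne_zero hfy hgy) this
  exact NoZeroDivisors.to_isDomain _

/-- The function field `k(C)`. -/
def AlgCurve.FunctionField (C : AlgCurve A) : Type _ := FractionRing C.coordRing

instance (C : AlgCurve A) : Field C.FunctionField :=
  inferInstanceAs (Field (FractionRing C.coordRing))

instance (C : AlgCurve A) : Algebra C.coordRing C.FunctionField :=
  inferInstanceAs (Algebra C.coordRing (FractionRing C.coordRing))

instance (C : AlgCurve A) : IsFractionRing C.coordRing C.FunctionField :=
  inferInstanceAs (IsFractionRing C.coordRing (FractionRing C.coordRing))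

instance (C : AlgCurve A) : Algebra ℂ C.FunctionField :=
  ((algebraMap C.coordRing C.FunctionField).comp (algebraMap ℂ C.coordRing)).toAlgebra

/-- A closed point of the smooth projective model of a curve over `ℂ` with function field `K`,
given by its local ring: a discrete valuation ring of `K` containing the constants, with fraction
field `K`. -/
structure CurvePoint (K : Type*) [Field K] [Algebra ℂ K] where
  localRing : ValuationSubring K
  const_mem : ∀ c : ℂ, algebraMap ℂ K c ∈ localRing
  isDVR : IsDiscreteValuationRing localRing

/-- A point of the smooth projective model of `C` is ideal if it does not lie over a point of the
affine curve `C`, that is, if some regular function on `C` has a pole there. -/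
def AlgCurve.IsIdealPoint (C : AlgCurve A) (x : CurvePoint C.FunctionField) : Prop :=
  ∃ f : C.coordRing, algebraMap C.coordRing C.FunctionField f ∉ x.localRing

/-- The inclusion of the constants in the residue field of a point. -/
def CurvePoint.constResidue {K : Type*} [Field K] [Algebra ℂ K] (x : CurvePoint K) (c : ℂ) :
    IsLocalRing.ResidueField x.localRing :=
  IsLocalRing.residue x.localRing ⟨algebraMap ℂ K c, x.const_mem c⟩

end Curves

/-! ### The representation variety and the character variety -/

section Varieties

variable (Γ : Type*) [Group Γ]

/-- The set of points of the `SL₂(ℂ)`-representation variety. -/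
abbrev RepPoints : Type _ := Γ →* Matrix.SpecialLinearGroup (Fin 2) ℂ

/-- The regular functions on the representation variety: polynomials in the matrix entries. -/
def repRing : Subalgebra ℂ (RepPoints Γ → ℂ) :=
  Algebra.adjoin ℂ {f | ∃ (g : Γ) (i j : Fin 2), f = fun ρ => (ρ g).1 i j}

variable {Γ} in
/-- The character of a representation. -/
def character (ρ : RepPoints Γ) : Γ → ℂ := fun g => (ρ g).1.trace

/-- The set of points of the `SL₂(ℂ)`-character variety. -/
abbrev CharPoints : Type _ := Set.range (character (Γ := Γ))

/-- The regular functions on the character variety: polynomials in the traces of the elements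
of `Γ`. -/
def charRing : Subalgebra ℂ (CharPoints Γ → ℂ) :=
  Algebra.adjoin ℂ {f | ∃ g : Γ, f = fun χ => χ.1 g}

variable {Γ}

/-- The trace map from the representation variety to the character variety. -/
def traceMap (ρ : RepPoints Γ) : CharPoints Γ := ⟨character ρ, ρ, rfl⟩

theorem comp_traceMap_mem {f : CharPoints Γ → ℂ} (hf : f ∈ charRing Γ) : f ∘ traceMap ∈ repRing Γ := by
  induction hf using Algebra.adjoin_induction with
  | mem f hf =>
    obtain ⟨g, rfl⟩ := hf
    have : ((fun χ : CharPoints Γ => χ.1 g) ∘ traceMap) =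
        (fun ρ : RepPoints Γ => (ρ g).1 0 0) + fun ρ : RepPoints Γ => (ρ g).1 1 1 := by
      funext ρ
      exact Matrix.trace_fin_two _
    rw [this]
    exact add_mem (Algebra.subset_adjoin ⟨g, 0, 0, rfl⟩) (Algebra.subset_adjoin ⟨g, 1, 1, rfl⟩)
  | algebraMap r => exact (repRing Γ).algebraMap_mem r
  | add f g _ _ hf hg => exact add_mem hf hg
  | mul f g _ _ hf hg => exact mul_mem hf hg

/-- A curve `C` in the character variety is a norm curve, with respect to the set `P` of elements
of `Γ` represented by nontrivial elements of the peripheral torus group, if it is an irreducible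
component and the trace of every element of `P` is nonconstant on `C`. -/
def IsNormCurve (C : AlgCurve (charRing Γ)) (P : Set Γ) : Prop :=
  C.carrier ∈ @irreducibleComponents (CharPoints Γ) (zariskiTopology (charRing Γ)) ∧
    ∀ g ∈ P, ¬ ∃ c : ℂ, ∀ χ ∈ C.carrier, χ.1 g = c

/-- A curve `D` in the representation variety that the trace map sends dominantly to `C`. -/
structure RepCurve (C : AlgCurve (charRing Γ)) extends AlgCurve (repRing Γ) where
  maps : ∀ ρ ∈ carrier, traceMap ρ ∈ C.carrier
  dense : C.carrier ⊆ @closure _ (zariskiTopology (charRing Γ)) (traceMap '' carrier)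

variable {C : AlgCurve (charRing Γ)}

/-- The function field `k(D)`. -/
abbrev RepCurve.FunctionField (D : RepCurve C) : Type _ := D.toAlgCurve.FunctionField

/-- Pullback of regular functions along the trace map `D → C`. -/
def RepCurve.pullback (D : RepCurve C) : C.coordRing →+* D.toAlgCurve.coordRing where
  toFun f := ⟨fun ρ => f.1 ⟨traceMap ρ.1, D.maps ρ.1 ρ.2⟩, by
    obtain ⟨_, f, hf, rfl⟩ := f
    exact ⟨f ∘ traceMap, comp_traceMap_mem hf, rfl⟩⟩
  map_one' := rfl
  map_mul' _ _ := rfl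
  map_zero' := rfl
  map_add' _ _ := rfl

theorem RepCurve.pullback_injective (D : RepCurve C) : Function.Injective D.pullback := by
  rw [injective_iff_map_eq_zero]
  intro f hf
  obtain ⟨_, f, hfA, rfl⟩ := f
  refine Subtype.ext (funext fun χ => ?_)
  change f χ.1 = 0
  by_contra hne
  obtain ⟨_, hy, ρ, hρ, rfl⟩ := (@mem_closure_iff _ (zariskiTopology (charRing Γ)) _ _).1
    (D.dense χ.2) {y | f y ≠ 0} (isOpen_ne_zero hfA) hne
  exact hy (congrFun (congrArg Subtype.val hf) ⟨ρ, hρ⟩)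

/-- The inclusion `k(C) → k(D)` induced by the trace map. -/
instance RepCurve.algebraFunctionField (D : RepCurve C) :
    Algebra C.FunctionField D.FunctionField :=
  (IsFractionRing.lift (A := C.coordRing) (K := C.FunctionField)
    (g := (algebraMap D.toAlgCurve.coordRing D.FunctionField).comp D.pullback)
    ((IsFractionRing.injective D.toAlgCurve.coordRing D.toAlgCurve.FunctionField).comp
      D.pullback_injective)).toAlgebra

/-- The matrix over the coordinate ring of `D` whose `ij` entry is `ρ ↦ ρ(g) i j`. -/
def RepCurve.regularMatrix (D : RepCurve C) (g : Γ) :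
    Matrix (Fin 2) (Fin 2) D.toAlgCurve.coordRing :=
  Matrix.of fun i j => ⟨fun ρ => (ρ.1 g).1 i j,
    fun ρ => (ρ g).1 i j, Algebra.subset_adjoin ⟨g, i, j, rfl⟩, rfl⟩

theorem RepCurve.regularMatrix_det (D : RepCurve C) (g : Γ) : (D.regularMatrix g).det = 1 := by
  rw [Matrix.det_fin_two]
  refine Subtype.ext (funext fun ρ => ?_)
  have := (ρ.1 g).2
  rw [Matrix.det_fin_two] at this
  exact this

theorem RepCurve.regularMatrix_one (D : RepCurve C) : D.regularMatrix 1 = 1 := by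
  refine Matrix.ext fun i j => Subtype.ext (funext fun ρ => ?_)
  change (ρ.1 1).1 i j = _
  rw [map_one]
  fin_cases i <;> fin_cases j <;> rfl

theorem RepCurve.regularMatrix_mul (D : RepCurve C) (g h : Γ) :
    D.regularMatrix (g * h) = D.regularMatrix g * D.regularMatrix h := by
  refine Matrix.ext fun i j => Subtype.ext (funext fun ρ => ?_)
  rw [Matrix.mul_apply, Fin.sum_univ_two]
  change (ρ.1 (g * h)).1 i j = (ρ.1 g).1 i 0 * (ρ.1 h).1 0 j + (ρ.1 g).1 i 1 * (ρ.1 h).1 1 j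
  rw [map_mul, Matrix.SpecialLinearGroup.coe_mul, Matrix.mul_apply, Fin.sum_univ_two]

/-- The representation of `Γ` over the coordinate ring of `D` given by these matrices. -/
def RepCurve.regularRep (D : RepCurve C) :
    Γ →* Matrix.SpecialLinearGroup (Fin 2) D.toAlgCurve.coordRing where
  toFun g := ⟨D.regularMatrix g, D.regularMatrix_det g⟩
  map_one' := Subtype.ext D.regularMatrix_one
  map_mul' g h := Subtype.ext (D.regularMatrix_mul g h)

/-- The tautological representation `P_C : Γ → SL₂(k(D))`. -/
def RepCurve.tautRep (D : RepCurve C) : Γ →* Matrix.SpecialLinearGroup (Fin 2) D.FunctionField :=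
  (Matrix.SpecialLinearGroup.map (algebraMap D.toAlgCurve.coordRing D.FunctionField)).comp
    D.regularRep

/-- A point `y` of the smooth projective model of `D` lies over the point `x` of that of `C`. -/
def RepCurve.PointLiesOver (D : RepCurve C) (y : CurvePoint D.FunctionField)
    (x : CurvePoint C.FunctionField) : Prop :=
  y.localRing.comap (algebraMap C.FunctionField D.FunctionField) = x.localRing

/-- The canonical quaternion algebra `A_{k(C)}`, the `k(C)`-algebra generated by the image of the
tautological representation. -/
def RepCurve.canonicalAlgebra (D : RepCurve C) :
    Subalgebra C.FunctionField (Matrix (Fin 2) (Fin 2) D.FunctionField) :=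
  Algebra.adjoin C.FunctionField (Set.range fun g => (D.tautRep g).1)

/-- `A_{k(C)}` is the set of finite sums `∑ αᵢ P_C(γᵢ)` with `αᵢ ∈ k(C)` and `γᵢ ∈ Γ`. -/
theorem RepCurve.canonicalAlgebra_eq_span (D : RepCurve C) :
    Subalgebra.toSubmodule D.canonicalAlgebra =
      Submodule.span C.FunctionField (Set.range fun g => (D.tautRep g).1) := by
  have h : (Submonoid.closure (Set.range fun g => (D.tautRep g).1) : Set _) =
      Set.range fun g => (D.tautRep g).1 := by
    refine Set.Subset.antisymm (fun a ha => ?_) Submonoid.subset_closure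
    induction ha using Submonoid.closure_induction with
    | mem a ha => exact ha
    | one => exact ⟨1, by simp⟩
    | mul a b _ _ ha hb =>
      obtain ⟨g, rfl⟩ := ha
      obtain ⟨k, rfl⟩ := hb
      exact ⟨g * k, by simp⟩
  rw [canonicalAlgebra, Algebra.adjoin_eq_span, h]

/-- For `g, h ∈ Γ`, the `𝒪ₓ`-span of `1, P_C(g), P_C(h), P_C(gh)` is an Azumaya algebra over `𝒪ₓ`
that extends `A_{k(C)}`, i.e. whose base change to `k(C)` is isomorphic to `A_{k(C)}`. -/
def RepCurve.IsTautologicalExtension (D : RepCurve C) (x : CurvePoint C.FunctionField)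
    (g h : Γ) : Prop :=
  ∃ Λ : Subalgebra x.localRing (Matrix (Fin 2) (Fin 2) D.FunctionField),
    Subalgebra.toSubmodule Λ = Submodule.span x.localRing
      {1, (D.tautRep g).1, (D.tautRep h).1, (D.tautRep (g * h)).1} ∧
    IsAzumaya x.localRing Λ ∧
    Nonempty (C.FunctionField ⊗[x.localRing] Λ ≃ₐ[C.FunctionField] D.canonicalAlgebra)

/-- `A_{k(C)}` tautologically extends over `x`. -/
def RepCurve.TautologicallyExtends (D : RepCurve C) (x : CurvePoint C.FunctionField) : Prop :=
  ∃ g h : Γ, D.IsTautologicalExtension x g h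

open Classical in
/-- The value of the limiting character at `g`: conjugate `P_C(g)` by an element of `GL₂(k(D))`
into `SL₂(𝒪_y)`, reduce modulo the maximal ideal, and take the trace. (The value does not depend on
the conjugate, which has the same trace as `P_C(g)`; it is `0` by convention if there is no such
conjugate.) It lies in the residue field of `y`, which contains `ℂ` through
`CurvePoint.constResidue`. -/
def RepCurve.limitingCharacter (D : RepCurve C) (y : CurvePoint D.FunctionField) (g : Γ) :
    IsLocalRing.ResidueField y.localRing :=
  if h : ∃ N : Matrix.SpecialLinearGroup (Fin 2) y.localRing,
      ∃ Q : Matrix.GeneralLinearGroup (Fin 2) D.FunctionField,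
        N.1.map (algebraMap y.localRing D.FunctionField) =
          Q.1 * (D.tautRep g).1 * (Q⁻¹).1 then
    (h.choose.1.map (IsLocalRing.residue y.localRing)).trace
  else 0

/-- The limiting character does not depend on the conjugate: it is the residue of the trace. -/
theorem RepCurve.limitingCharacter_eq (D : RepCurve C) (y : CurvePoint D.FunctionField) (g : Γ)
    (N : Matrix.SpecialLinearGroup (Fin 2) y.localRing)
    (Q : Matrix.GeneralLinearGroup (Fin 2) D.FunctionField)
    (h : N.1.map (algebraMap y.localRing D.FunctionField) =
      Q.1 * (D.tautRep g).1 * (Q⁻¹).1) :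
    D.limitingCharacter y g = IsLocalRing.residue y.localRing N.1.trace := by
  have key : ∀ (N : Matrix.SpecialLinearGroup (Fin 2) y.localRing)
      (Q : Matrix.GeneralLinearGroup (Fin 2) D.FunctionField),
      N.1.map (algebraMap y.localRing D.FunctionField) = Q.1 * (D.tautRep g).1 * (Q⁻¹).1 →
      algebraMap y.localRing D.FunctionField N.1.trace = (D.tautRep g).1.trace := by
    intro N Q h
    have h2 := congrArg Matrix.trace h
    rw [Matrix.trace_mul_cycle, Units.inv_mul, one_mul] at h2
    rw [← h2, Matrix.trace_fin_two, Matrix.trace_fin_two, map_add]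
    rfl
  have hex : ∃ N : Matrix.SpecialLinearGroup (Fin 2) y.localRing,
      ∃ Q : Matrix.GeneralLinearGroup (Fin 2) D.FunctionField,
        N.1.map (algebraMap y.localRing D.FunctionField) =
          Q.1 * (D.tautRep g).1 * (Q⁻¹).1 := ⟨N, Q, h⟩
  obtain ⟨Q', hQ'⟩ := hex.choose_spec
  have htr : hex.choose.1.trace = N.1.trace :=
    IsFractionRing.injective y.localRing D.FunctionField ((key _ _ hQ').trans (key _ _ h).symm)
  rw [limitingCharacter, dif_pos hex, ← htr, Matrix.trace_fin_two, Matrix.trace_fin_two, map_add]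
  rfl

/-- A two-dimensional representation with no invariant line. -/
def IsIrreducibleRep {G : Type*} [Group G] (ρ : RepPoints G) : Prop :=
  ∀ W : Submodule ℂ (Fin 2 → ℂ), (∀ g, ∀ w ∈ W, (ρ g).1.mulVec w ∈ W) → W = ⊥ ∨ W = ⊤

end Varieties

/-! ### The Bass-Serre tree of a discrete valuation -/

section Tree

variable {F : Type*} [Field F] (O : ValuationSubring F)

/-- `O`-lattices in `F²`. -/
abbrev OLattice : Type _ := {L : Submodule O (Fin 2 → F) // L.IsLattice F}

/-- Two lattices are homothetic if they differ by a scalar in `Fˣ`. -/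
def latticeSetoid : Setoid (OLattice O) where
  r L L' := ∃ c : F, c ≠ 0 ∧ (L'.1 : Set (Fin 2 → F)) = (fun v => c • v) '' (L.1 : Set (Fin 2 → F))
  iseqv :=
    { refl := fun L => ⟨1, one_ne_zero, by simp⟩
      symm := by
        rintro L L' ⟨c, hc, h⟩
        refine ⟨c⁻¹, inv_ne_zero hc, ?_⟩
        rw [h, Set.image_image]
        simp [smul_smul, inv_mul_cancel₀ hc]
      trans := by
        rintro L L' L'' ⟨c, hc, h⟩ ⟨d, hd, h'⟩
        refine ⟨d * c, mul_ne_zero hd hc, ?_⟩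
        rw [h', h, Set.image_image]
        simp [smul_smul] }

/-- The vertices of the tree: homothety classes of lattices. -/
abbrev TreeVertex : Type _ := Quotient (latticeSetoid O)

/-- The tree: two vertices are adjacent if they have representatives `L`, `L'` with
`πL ⊊ L' ⊊ L`. -/
def bassSerreTree : SimpleGraph (TreeVertex O) :=
  SimpleGraph.fromRel fun u w => ∃ L L' : OLattice O, ⟦L⟧ = u ∧ ⟦L'⟧ = w ∧
    IsLocalRing.maximalIdeal O • L.1 < L'.1 ∧ L'.1 < L.1

/-- The action of `SL₂(F)` on lattices. -/
def OLattice.act (g : Matrix.SpecialLinearGroup (Fin 2) F) (L : OLattice O) : OLattice O :=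
  ⟨L.1.map (g.1.mulVecLin.restrictScalars O), by
    constructor
    · exact L.2.fg.map _
    · have hsurj : Function.Surjective g.1.mulVecLin := fun v =>
        ⟨(g⁻¹).1.mulVec v, by
          rw [Matrix.mulVecLin_apply, Matrix.mulVec_mulVec, ← Matrix.SpecialLinearGroup.coe_mul,
            mul_inv_cancel]
          simp⟩
      have : ((L.1.map (g.1.mulVecLin.restrictScalars O) : Submodule O (Fin 2 → F)) :
          Set (Fin 2 → F)) = g.1.mulVecLin '' (L.1 : Set (Fin 2 → F)) := rfl
      rw [this, Submodule.span_image, L.2.span_eq_top, Submodule.map_top,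
        LinearMap.range_eq_top.2 hsurj]⟩

/-- The action of `SL₂(F)` on the vertices of the tree. -/
def TreeVertex.act (g : Matrix.SpecialLinearGroup (Fin 2) F) : TreeVertex O → TreeVertex O :=
  Quotient.map (OLattice.act O g) (by
    rintro L L' ⟨c, hc, h⟩
    refine ⟨c, hc, ?_⟩
    change g.1.mulVecLin '' (L'.1 : Set (Fin 2 → F)) =
      (fun v => c • v) '' (g.1.mulVecLin '' (L.1 : Set (Fin 2 → F)))
    rw [h, Set.image_image, Set.image_image]
    simp only [map_smul])

end Tree

section Realization

variable {V : Type*} (G : SimpleGraph V)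

/-- The vertex `u` as a point of the geometric realization. -/
def vertexPoint (u : V) : V → ℝ := Set.indicator {u} 1

/-- The geometric realization of a graph in barycentric coordinates, topologized as a subspace
of `V → ℝ`. -/
def realization : Set (V → ℝ) :=
  {t | ∃ u w, (u = w ∨ G.Adj u w) ∧ t ∈ segment ℝ (vertexPoint u) (vertexPoint w)}

/-- The midpoints of the edges. -/
def midpoints : Set (V → ℝ) :=
  {t | ∃ u w, G.Adj u w ∧ t = midpoint ℝ (vertexPoint u) (vertexPoint w)}

end Realization

/-! ### Hyperbolic 3-manifolds -/

section Manifolds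

/-- The upper half-space `{(z, t) | t > 0}`, with metric `(|dz|² + dt²) / t²`. -/
def upperHalfSpace : Set (ℂ × ℝ) := {q | 0 < q.2}

/-- The action of `SL₂(ℂ)` on the upper half-space by orientation-preserving isometries. -/
def moebius (B : Matrix.SpecialLinearGroup (Fin 2) ℂ) (q : ℂ × ℝ) : ℂ × ℝ :=
  let a := B.1 0 0
  let b := B.1 0 1
  let c := B.1 1 0
  let d := B.1 1 1
  let n : ℝ := Complex.normSq (c * q.1 + d) + Complex.normSq c * q.2 ^ 2
  (((a * q.1 + b) * star (c * q.1 + d) + a * star c * (q.2 : ℂ) ^ 2) / (n : ℂ), q.2 / n)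

/-- The quotient of the upper half-space by a subgroup of `SL₂(ℂ)`. -/
def orbitSpace (Δ : Subgroup (Matrix.SpecialLinearGroup (Fin 2) ℂ)) : Type :=
  Quot fun q q' : upperHalfSpace => ∃ B ∈ Δ, (q' : ℂ × ℝ) = moebius B q

instance (Δ : Subgroup (Matrix.SpecialLinearGroup (Fin 2) ℂ)) : TopologicalSpace (orbitSpace Δ) :=
  inferInstanceAs (TopologicalSpace (Quot _))

variable (M : Type*) [TopologicalSpace M] [ChartedSpace (EuclideanHalfSpace 3) M]

/-- `M` is a compact 3-manifold whose boundary is one torus and whose interior is homeomorphic to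
a quotient of hyperbolic 3-space by a discrete group of finite covolume, the image in `PSL₂(ℂ)`
of `Δ`, that acts freely. -/
def IsOneCuspedHyperbolic : Prop :=
  CompactSpace M ∧ ConnectedSpace M ∧ T2Space M ∧ IsManifold (𝓡∂ 3) ∞ M ∧
  Nonempty ((𝓡∂ 3).boundary M ≃ₜ Circle × Circle) ∧
  ∃ Δ : Subgroup (Matrix.SpecialLinearGroup (Fin 2) ℂ),
    DiscreteTopology Δ ∧
    (∀ B ∈ Δ, ∀ q ∈ upperHalfSpace, moebius B q = q → B = 1 ∨ B = -1) ∧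
    (∃ s ⊆ upperHalfSpace, MeasurableSet s ∧
      (∫⁻ q in s, ENNReal.ofReal (1 / q.2 ^ 3)) < ⊤ ∧
      ∀ q ∈ upperHalfSpace, ∃ B ∈ Δ, moebius B q ∈ s) ∧
    Nonempty ((𝓡∂ 3).interior M ≃ₜ orbitSpace Δ)

variable {M}

/-- The inclusion of a subspace. -/
def incl (Z : Set M) : C(Z, M) := ⟨Subtype.val, continuous_subtype_val⟩

/-- The elements of `π₁(M, m)` represented by nontrivial elements of `π₁(∂M)`, along arbitrary paths
from `m` to the boundary. -/
def peripheralElements (m : M) : Set (FundamentalGroup M m) :=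
  {g | ∃ (b : (𝓡∂ 3).boundary M) (α : Path.Homotopic.Quotient m (b : M))
      (δ : FundamentalGroup ((𝓡∂ 3).boundary M) b),
    δ ≠ 1 ∧ g = FundamentalGroup.fromPath
      (α.trans ((Path.Homotopic.Quotient.map δ.toPath (incl _)).trans α.symm))}

/-- A proper bicollar `S × [-1, 1] → M` of a subset `S = S × {0}`. -/
def IsBicollar (S : Set M) (c : C(S × Set.Icc (-1 : ℝ) 1, M)) : Prop :=
  Function.Injective c ∧
  (∀ s : S, c (s, ⟨0, by norm_num⟩) = s) ∧
  IsOpen (c '' {p | |(p.2 : ℝ)| < 1}) ∧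
  ∀ p, c p ∈ (𝓡∂ 3).boundary M ↔ (p.1 : M) ∈ (𝓡∂ 3).boundary M

/-- A nonempty compact surface, possibly disconnected, properly embedded in `M`
(`∂S = S ∩ ∂M`), and two-sided. -/
def IsProperTwoSidedSurface (S : Set M) : Prop :=
  S.Nonempty ∧ IsCompact S ∧
  (∃ _ : ChartedSpace (EuclideanHalfSpace 2) S,
    ∀ s : S, s ∈ (𝓡∂ 2).boundary S ↔ (s : M) ∈ (𝓡∂ 3).boundary M) ∧
  ∃ c, IsBicollar S c

/-- `A` is boundary-parallel: it cuts off a product `A × [0, 1]` that meets `∂M` in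
`A × {1} ∪ ∂A × [0, 1]`, where `A = A × {0}`. -/
def IsBoundaryParallel (A : Set M) : Prop :=
  ∃ j : C(A × Set.Icc (0 : ℝ) 1, M), Function.Injective j ∧
    (∀ a : A, j (a, ⟨0, by norm_num⟩) = a) ∧
    ∀ p, j p ∈ (𝓡∂ 3).boundary M ↔ (p.2 : ℝ) = 1 ∨ (p.1 : M) ∈ (𝓡∂ 3).boundary M

/-- Essential surfaces: properly embedded, two-sided, `π₁`-injective, and with no boundary-parallel
component. -/
def IsEssentialSurface (S : Set M) : Prop :=
  IsProperTwoSidedSurface S ∧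
  (∀ s : S, Function.Injective (FundamentalGroup.map (incl S) s)) ∧
  ∀ s ∈ S, ¬ IsBoundaryParallel (connectedComponentIn S s)

/-- Finitely many parallel copies of the components of `S` inside a bicollar: the copies of the
component of `s` are at the levels `t ∈ T s`. -/
def parallelCopies (S : Set M) (c : C(S × Set.Icc (-1 : ℝ) 1, M)) (T : S → Finset ℝ) : Set M :=
  {m | ∃ (s : S) (t : Set.Icc (-1 : ℝ) 1), (t : ℝ) ∈ T s ∧ m = c (s, t)}

/-- Let `p : E → M` be a universal covering. A map `f` from `E` to the vertex functions on the tree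
is equivariant for a representation `ρ` of `π₁(M, p e₀)`. If `γ · e` is the endpoint of the
lift from `e₀` of the loop `γ` followed by the image of a path from `e₀` to `e`, then equivariance
is `f (γ · e) = ρ(γ)⁻¹ f(e)`: in Mathlib `γ * δ` is the class of `δ` followed by `γ`, so that the
left action of `π₁(M)` by deck transformations is `(γ, e) ↦ γ⁻¹ · e`. -/
def IsEquivariantMap {E F : Type*} [TopologicalSpace E] [Field F] {O : ValuationSubring F}
    (p : C(E, M)) (e₀ : E) (ρ : FundamentalGroup M (p e₀) →* Matrix.SpecialLinearGroup (Fin 2) F)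
    (f : E → TreeVertex O → ℝ) : Prop :=
  ∀ (γ : FundamentalGroup M (p e₀)) (e e' : E)
    (α : Path.Homotopic.Quotient e₀ e) (α' : Path.Homotopic.Quotient e₀ e')
    (h : p e' = p e), α'.map p = (γ.toPath.trans (α.map p)).cast rfl h →
    ∀ u, f e' u = f e (TreeVertex.act O (ρ γ) u)

/-- The surface `S` is detected by the tree of `O`, on which `π₁(M)` acts through `ρ`: it is
essential, and there is an equivariant continuous map from the universal cover `E` to the
tree, transverse to the midpoints of the edges, such that the inverse image of the midpoints is the
preimage in `E` of `S`, where components of `S` may be replaced by several parallel copies of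
themselves. -/
def IsDetected {E F : Type*} [TopologicalSpace E] [Field F] (O : ValuationSubring F)
    (p : C(E, M)) (e₀ : E) (ρ : FundamentalGroup M (p e₀) →* Matrix.SpecialLinearGroup (Fin 2) F)
    (S : Set M) : Prop :=
  IsEssentialSurface S ∧
  ∃ (c : C(S × Set.Icc (-1 : ℝ) 1, M)) (T : S → Finset ℝ) (f : E → TreeVertex O → ℝ),
    IsBicollar S c ∧
    IsLocallyConstant T ∧ (∀ s, 0 ∈ T s ∧ ∀ t ∈ T s, |t| < 1) ∧
    Continuous f ∧ (∀ e, f e ∈ realization (bassSerreTree O)) ∧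
    IsEquivariantMap p e₀ ρ f ∧
    (∀ e, f e ∈ midpoints (bassSerreTree O) ↔ p e ∈ parallelCopies S c T) ∧
    ∀ e u w, (bassSerreTree O).Adj u w → f e = midpoint ℝ (vertexPoint u) (vertexPoint w) →
      e ∈ closure {e' | 1 / 2 < f e' u} ∧ e ∈ closure {e' | 1 / 2 < f e' w}

/-- The component of `M \ S` that contains the point `m`. -/
abbrev complementComponent (S : Set M) (m : M) : Set M := connectedComponentIn Sᶜ m

/-- The homomorphism `π₁(M') → π₁(M)` induced by the inclusion of the component `M'` of `M \ S`
that contains the base point. -/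
def complementMap (S : Set M) (m : M) (hm : m ∉ S) :
    FundamentalGroup (complementComponent S m) ⟨m, mem_connectedComponentIn hm⟩ →*
      FundamentalGroup M m :=
  FundamentalGroup.map (incl (complementComponent S m)) ⟨m, mem_connectedComponentIn hm⟩

end Manifolds

end CullerShalen

end

open CullerShalen

/-! For `a, b` in `SL₂` with traces `s, t, u` of `a`, `b`, `ab`, the polynomial `commTrace s t u` is
`tr [a, b] - 2`. It governs both ends of the argument. Over `ℂ` it is nonzero when `a, b` have no
common invariant line (`commTrace_ne_zero`). Over any commutative ring the Gram matrix of `1, a, b,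
ab` for the trace form has determinant `-commTrace ^ 2` (`det_pairGram`), so if `commTrace` is a
unit then these four matrices have a unimodular trace form. When they span an order, the Casimir
identity makes that order Azumaya (`IsTraceGram.isAzumaya`).

Geometry links the two ends. A loop in `M'` misses `S`, hence is freely homotopic to a loop missing
all the parallel copies of `S`. The image in the tree of the lift of that loop avoids midpoints, so
it stays near one vertex, which the element of the loop must fix (`exists_act_eq_of_loop`). An
elliptic element is conjugate into `SL₂(𝒪_y)`, so its trace lies in `𝒪_y ∩ k(C) = 𝒪ₓ` and reduces to
the limiting character.

If `ρ_∞` is irreducible on `⟨g, h⟩`, then `commTrace` of the traces of `P(g), P(h), P(gh)` has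
nonzero residue and is a unit of `𝒪ₓ`. Expansion in the dual basis shows that the `𝒪ₓ`-span of `1,
P(g), P(h), P(gh)` is the algebra generated over `𝒪ₓ` by `P(π₁(M'))`, and that their `k(C)`-span is
`A_{k(C)}` (`adjoin_range_eq_span`). A suitable pair exists because a group is not the union of two
proper subgroups. -/

noncomputable section

namespace CullerShalen

open scoped unitInterval

/-! ### Irreducibility of two-generator subgroups of `SL₂(ℂ)` -/

section Irreducibility

/-- The trace of the commutator of two elements of `SL₂`, minus `2`, as a function of the traces of
the elements and of their product. -/
def commTrace {R : Type*} [CommRing R] (s t u : R) : R := s ^ 2 + t ^ 2 + u ^ 2 - s * t * u - 4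

theorem map_commTrace {R S : Type*} [CommRing R] [CommRing S] (f : R →+* S) (s t u : R) :
    f (commTrace s t u) = commTrace (f s) (f t) (f u) := by
  have h4 : f 4 = 4 := map_ofNat f 4
  simp [commTrace, h4]

/-- Writing `ab - ba = ([a, b] - 1) ba`, the determinant is `det ([a, b] - 1) = 2 - tr [a, b]`. -/
theorem det_mul_sub_mul {R : Type*} [CommRing R] {a b : Matrix (Fin 2) (Fin 2) R} (ha : a.det = 1)
    (hb : b.det = 1) :
    (a * b - b * a).det = -commTrace a.trace b.trace (a * b).trace := by
  rw [Matrix.det_fin_two] at ha hb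
  simp only [Matrix.det_fin_two, Matrix.sub_apply, Matrix.mul_apply, Fin.sum_univ_two,
    Matrix.trace_fin_two, commTrace]
  generalize a 0 0 = a₁, a 0 1 = a₂, a 1 0 = a₃, a 1 1 = a₄ at *
  generalize b 0 0 = b₁, b 0 1 = b₂, b 1 0 = b₃, b 1 1 = b₄ at *
  linear_combination (4 * (b₁ * b₄ - b₂ * b₃) - (b₁ + b₄) ^ 2) * ha + (4 - (a₁ + a₄) ^ 2) * hb

variable {G : Type*} [Group G]

/-- By Cayley–Hamilton, `a⁻¹ = tr(a) - a` in `SL₂`. -/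
theorem mulVec_inv_mem (a : Matrix.SpecialLinearGroup (Fin 2) ℂ) {W : Submodule ℂ (Fin 2 → ℂ)}
    (h : ∀ w ∈ W, a.1.mulVec w ∈ W) : ∀ w ∈ W, (a⁻¹).1.mulVec w ∈ W := by
  intro w hw
  have : (a⁻¹).1.mulVec w = a.1.trace • w - a.1.mulVec w := by
    rw [Matrix.SpecialLinearGroup.coe_inv, Matrix.adjugate_fin_two]
    ext i
    fin_cases i <;>
      simp [Matrix.mulVec, dotProduct, Fin.sum_univ_two, Matrix.trace_fin_two] <;> ring
  rw [this]
  exact W.sub_mem (W.smul_mem _ hw) (h w hw)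

/-- Irreducibility of the restriction to `⟨g, h⟩` can be tested on `g` and `h`. -/
theorem isIrreducibleRep_closure_pair_iff (ρ : RepPoints G) (g h : G) :
    IsIrreducibleRep (ρ.comp (Subgroup.closure {g, h}).subtype) ↔
      ∀ W : Submodule ℂ (Fin 2 → ℂ), (∀ w ∈ W, (ρ g).1.mulVec w ∈ W) →
        (∀ w ∈ W, (ρ h).1.mulVec w ∈ W) → W = ⊥ ∨ W = ⊤ := by
  constructor
  · intro H W hg hh
    refine H W fun k => ?_
    obtain ⟨k, hk⟩ := k
    change ∀ w ∈ W, (ρ k).1.mulVec w ∈ W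
    induction hk using Subgroup.closure_induction with
    | mem k hk =>
      rcases hk with rfl | rfl
      exacts [hg, hh]
    | one => simp
    | mul k l _ _ hk hl =>
      intro w hw
      rw [map_mul, Matrix.SpecialLinearGroup.coe_mul, ← Matrix.mulVec_mulVec]
      exact hk _ (hl _ hw)
    | inv k _ hk =>
      rw [map_inv]
      exact mulVec_inv_mem _ hk
  · intro H W hW
    exact H W (hW ⟨g, Subgroup.subset_closure (by simp)⟩)
      (hW ⟨h, Subgroup.subset_closure (by simp)⟩)

/-- An endomorphism of `ℂ²` has an eigenvector. -/
theorem exists_ker_sub_smul (a : Matrix (Fin 2) (Fin 2) ℂ) :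
    ∃ c : ℂ, LinearMap.ker (a - c • 1).mulVecLin ≠ ⊥ := by
  obtain ⟨c, hc⟩ := Module.End.exists_eigenvalue a.mulVecLin
  refine ⟨c, ?_⟩
  obtain ⟨v, hv⟩ := hc.exists_hasEigenvector
  intro h
  refine hv.2 ((Submodule.mem_bot ℂ).1 (h ▸ ?_))
  have := hv.apply_eq_smul
  rw [Matrix.mulVecLin_apply] at this
  rw [LinearMap.mem_ker, Matrix.mulVecLin_apply, Matrix.sub_mulVec, this, Matrix.smul_mulVec,
    Matrix.one_mulVec, sub_self]

theorem mulVecLin_ker_eq_top_iff (a : Matrix (Fin 2) (Fin 2) ℂ) :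
    LinearMap.ker a.mulVecLin = ⊤ ↔ a = 0 := by
  rw [LinearMap.ker_eq_top]
  constructor
  · intro h
    refine Matrix.ext_of_mulVec_single fun i => ?_
    rw [← Matrix.mulVecLin_apply, h]
    ext j
    simp
  · rintro rfl
    simp

theorem mulVec_mem_ker_of_commute {a c : Matrix (Fin 2) (Fin 2) ℂ} (h : a * c = c * a) :
    ∀ w ∈ LinearMap.ker c.mulVecLin, a.mulVec w ∈ LinearMap.ker c.mulVecLin := by
  intro w hw
  rw [LinearMap.mem_ker, Matrix.mulVecLin_apply] at hw ⊢
  rw [Matrix.mulVec_mulVec, ← h, ← Matrix.mulVec_mulVec, hw, Matrix.mulVec_zero]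

/-- An eigenspace of whichever matrix is not scalar is a line preserved by both; if both are scalar,
any line will do. -/
theorem exists_invariant_of_commute {a b : Matrix (Fin 2) (Fin 2) ℂ} (h : a * b = b * a) :
    ∃ W : Submodule ℂ (Fin 2 → ℂ), (∀ w ∈ W, a.mulVec w ∈ W) ∧ (∀ w ∈ W, b.mulVec w ∈ W) ∧
      W ≠ ⊥ ∧ W ≠ ⊤ := by
  by_cases hs : ∃ c : ℂ, a = c • 1
  · obtain ⟨c, rfl⟩ := hs
    have ha : ∀ W : Submodule ℂ (Fin 2 → ℂ), ∀ w ∈ W,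
        (c • (1 : Matrix (Fin 2) (Fin 2) ℂ)).mulVec w ∈ W := fun W w hw => by
      rw [Matrix.smul_mulVec, Matrix.one_mulVec]
      exact W.smul_mem c hw
    by_cases hs' : ∃ d : ℂ, b = d • 1
    · obtain ⟨d, rfl⟩ := hs'
      refine ⟨ℂ ∙ (Pi.single 0 1), ha _, fun w hw => ?_, ?_, ?_⟩
      · rw [Matrix.smul_mulVec, Matrix.one_mulVec]
        exact Submodule.smul_mem _ d hw
      · simp
      · intro h
        obtain ⟨e, he⟩ := Submodule.mem_span_singleton.1
          (h ▸ Submodule.mem_top : (Pi.single 1 1 : Fin 2 → ℂ) ∈ ℂ ∙ (Pi.single 0 1))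
        simpa using congrFun he 1
    · obtain ⟨d, hd⟩ := exists_ker_sub_smul b
      refine ⟨_, ha _, mulVec_mem_ker_of_commute ?_, hd, fun h => hs' ⟨d, ?_⟩⟩
      · simp [mul_sub, sub_mul]
      · exact sub_eq_zero.1 ((mulVecLin_ker_eq_top_iff _).1 h)
  · obtain ⟨c, hc⟩ := exists_ker_sub_smul a
    refine ⟨_, mulVec_mem_ker_of_commute ?_, mulVec_mem_ker_of_commute ?_, hc,
      fun h => hs ⟨c, ?_⟩⟩
    · simp [mul_sub, sub_mul]
    · simp [mul_sub, sub_mul, h]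
    · exact sub_eq_zero.1 ((mulVecLin_ker_eq_top_iff _).1 h)

/-- Polarized Cayley–Hamilton gives `ca + ac = tr(a) c` once `tr c = tr (ac) = 0`, so `c` kills `aw`
whenever it kills `w`. -/
theorem mulVec_mem_ker_of_trace_eq_zero {a c : Matrix (Fin 2) (Fin 2) ℂ} (hc : c.trace = 0)
    (hac : (a * c).trace = 0) :
    ∀ w ∈ LinearMap.ker c.mulVecLin, a.mulVec w ∈ LinearMap.ker c.mulVecLin := by
  intro w hw
  rw [LinearMap.mem_ker, Matrix.mulVecLin_apply] at hw ⊢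
  have key : c * a = a.trace • c - a * c := by
    rw [Matrix.trace_fin_two] at hc hac
    simp only [Matrix.mul_apply, Fin.sum_univ_two] at hac
    ext i j
    fin_cases i <;> fin_cases j <;>
      simp [Matrix.mul_apply, Fin.sum_univ_two, Matrix.trace_fin_two]
    · linear_combination hac - a 1 1 * hc
    · linear_combination a 0 1 * hc
    · linear_combination a 1 0 * hc
    · linear_combination hac - a 0 0 * hc
  rw [Matrix.mulVec_mulVec, key, Matrix.sub_mulVec, Matrix.smul_mulVec, hw,
    ← Matrix.mulVec_mulVec, hw]
  simp

/-- Two elements of `SL₂(ℂ)` whose commutator has trace `2` have a common eigenvector. -/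
theorem exists_invariant_of_commTrace_eq_zero (a b : Matrix.SpecialLinearGroup (Fin 2) ℂ)
    (h : commTrace a.1.trace b.1.trace (a * b).1.trace = 0) :
    ∃ W : Submodule ℂ (Fin 2 → ℂ), (∀ w ∈ W, a.1.mulVec w ∈ W) ∧ (∀ w ∈ W, b.1.mulVec w ∈ W) ∧
      W ≠ ⊥ ∧ W ≠ ⊤ := by
  obtain ⟨a, ha⟩ := a
  obtain ⟨b, hb⟩ := b
  dsimp only at *
  by_cases hc : a * b = b * a
  · exact exists_invariant_of_commute hc
  have hdet : (a * b - b * a).det = 0 := by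
    rw [det_mul_sub_mul ha hb]
    exact neg_eq_zero.2 h
  have htr : (a * b - b * a).trace = 0 := by
    rw [Matrix.trace_sub, Matrix.trace_mul_comm, sub_self]
  -- The commutator `ab - ba` is nonzero and singular, so its kernel is a line. It has trace zero,
  -- as do its products with `a` and with `b`, so the line is invariant.
  refine ⟨LinearMap.ker (a * b - b * a).mulVecLin, mulVec_mem_ker_of_trace_eq_zero htr ?_,
    mulVec_mem_ker_of_trace_eq_zero htr ?_, ?_, ?_⟩
  · rw [mul_sub, Matrix.trace_sub, Matrix.trace_mul_comm a (b * a), Matrix.mul_assoc b a a,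
      Matrix.trace_mul_comm b (a * a), Matrix.mul_assoc, sub_self]
  · rw [mul_sub, Matrix.trace_sub, Matrix.trace_mul_comm b (a * b), Matrix.mul_assoc a b b,
      Matrix.trace_mul_comm a (b * b), Matrix.mul_assoc, sub_self]
  · intro hbot
    obtain ⟨v, hv, hv0⟩ := Matrix.exists_mulVec_eq_zero_iff.2 hdet
    exact hv ((Submodule.mem_bot ℂ).1 (hbot ▸ hv0))
  · intro htop
    exact hc (sub_eq_zero.1 ((mulVecLin_ker_eq_top_iff _).1 htop))

theorem commTrace_ne_zero (ρ : RepPoints G) (g h : G)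
    (H : IsIrreducibleRep (ρ.comp (Subgroup.closure {g, h}).subtype)) :
    commTrace (character ρ g) (character ρ h) (character ρ (g * h)) ≠ 0 := by
  intro h0
  rw [isIrreducibleRep_closure_pair_iff] at H
  rw [character, character, character, map_mul] at h0
  obtain ⟨W, h1, h2, h3, h4⟩ := exists_invariant_of_commTrace_eq_zero _ _ h0
  exact (H W h1 h2).elim h3 h4

theorem not_commute_of_isIrreducibleRep (ρ : RepPoints G) (g h : G)
    (H : IsIrreducibleRep (ρ.comp (Subgroup.closure {g, h}).subtype)) : g * h ≠ h * g := by
  intro hcomm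
  have := congrArg (fun k => (ρ k).1) hcomm
  simp only [map_mul, Matrix.SpecialLinearGroup.coe_mul] at this
  obtain ⟨W, h1, h2, h3, h4⟩ := exists_invariant_of_commute this
  rw [isIrreducibleRep_closure_pair_iff] at H
  exact (H W h1 h2).elim h3 h4

/-- A proper nonzero subspace of `ℂ²` is spanned by any of its nonzero vectors. -/
theorem eq_span_singleton {W : Submodule ℂ (Fin 2 → ℂ)} (hW : W ≠ ⊤) {v : Fin 2 → ℂ} (hv : v ∈ W)
    (hv0 : v ≠ 0) : W = ℂ ∙ v := by
  refine (Submodule.eq_of_le_of_finrank_le ((Submodule.span_singleton_le_iff_mem v W).2 hv) ?_).symm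
  rw [finrank_span_singleton hv0]
  have := Submodule.finrank_lt hW
  rw [Module.finrank_fin_fun] at this
  omega

/-- A nonscalar endomorphism of `ℂ²` has at most two invariant lines. -/
theorem exists_two_invariant (a : Matrix (Fin 2) (Fin 2) ℂ) (ha : ¬ ∃ c : ℂ, a = c • 1) :
    ∃ W₁ W₂ : Submodule ℂ (Fin 2 → ℂ), (W₁ ≠ ⊥ ∧ W₁ ≠ ⊤) ∧ (W₂ ≠ ⊥ ∧ W₂ ≠ ⊤) ∧
      ∀ W : Submodule ℂ (Fin 2 → ℂ), (∀ w ∈ W, a.mulVec w ∈ W) → W ≠ ⊥ → W ≠ ⊤ →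
        W = W₁ ∨ W = W₂ := by
  have hker : ∀ c, LinearMap.ker (a - c • 1).mulVecLin ≠ ⊤ := fun c h =>
    ha ⟨c, sub_eq_zero.1 ((mulVecLin_ker_eq_top_iff _).1 h)⟩
  have hline : ∀ W : Submodule ℂ (Fin 2 → ℂ), (∀ w ∈ W, a.mulVec w ∈ W) → W ≠ ⊥ → W ≠ ⊤ →
      ∃ c, W = LinearMap.ker (a - c • 1).mulVecLin ∧ c ^ 2 - a.trace * c + a.det = 0 := by
    intro W hW hbot htop
    obtain ⟨v, hv, hv0⟩ := W.exists_mem_ne_zero_of_ne_bot hbot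
    have hWv := eq_span_singleton htop hv hv0
    obtain ⟨c, hc⟩ := Submodule.mem_span_singleton.1 (hWv ▸ hW v hv)
    have hvk : v ∈ LinearMap.ker (a - c • 1).mulVecLin := by
      rw [LinearMap.mem_ker, Matrix.mulVecLin_apply, Matrix.sub_mulVec, Matrix.smul_mulVec,
        Matrix.one_mulVec, hc, sub_self]
    refine ⟨c, hWv.trans (eq_span_singleton (hker c) hvk hv0).symm, ?_⟩
    have : (a - c • 1).det = 0 := Matrix.exists_mulVec_eq_zero_iff.1 ⟨v, hv0, hvk⟩
    rw [Matrix.det_fin_two] at this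
    simp only [Matrix.sub_apply, Matrix.smul_apply, Matrix.one_apply_eq, smul_eq_mul, mul_one,
      Matrix.one_apply_ne zero_ne_one, Matrix.one_apply_ne one_ne_zero, mul_zero, sub_zero] at this
    rw [Matrix.trace_fin_two, Matrix.det_fin_two]
    linear_combination this
  obtain ⟨c, hc⟩ := exists_ker_sub_smul a
  have hcroot : c ^ 2 - a.trace * c + a.det = 0 := by
    obtain ⟨v, hv, hv0⟩ := Submodule.exists_mem_ne_zero_of_ne_bot hc
    have : (a - c • 1).det = 0 := Matrix.exists_mulVec_eq_zero_iff.1 ⟨v, hv0, hv⟩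
    rw [Matrix.det_fin_two] at this
    simp only [Matrix.sub_apply, Matrix.smul_apply, Matrix.one_apply_eq, smul_eq_mul, mul_one,
      Matrix.one_apply_ne zero_ne_one, Matrix.one_apply_ne one_ne_zero, mul_zero, sub_zero] at this
    rw [Matrix.trace_fin_two, Matrix.det_fin_two]
    linear_combination this
  have hroots : ∀ d, d ^ 2 - a.trace * d + a.det = 0 → d = c ∨ d = a.trace - c := by
    intro d hd
    have : (d - c) * (d - (a.trace - c)) = 0 := by linear_combination hd - hcroot
    rcases mul_eq_zero.1 this with h | h
    exacts [.inl (sub_eq_zero.1 h), .inr (sub_eq_zero.1 h)]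
  -- The second eigenvalue is `tr a - c`, so its eigenspace is in fact never zero; the case split
  -- avoids having to prove this.
  by_cases hd : LinearMap.ker (a - (a.trace - c) • 1).mulVecLin = ⊥
  · refine ⟨_, _, ⟨hc, hker c⟩, ⟨hc, hker c⟩, fun W hW hbot htop => ?_⟩
    obtain ⟨e, rfl, he⟩ := hline W hW hbot htop
    rcases hroots e he with rfl | rfl
    exacts [.inl rfl, (hbot hd).elim]
  · refine ⟨_, _, ⟨hc, hker c⟩, ⟨hd, hker _⟩, fun W hW hbot htop => ?_⟩
    obtain ⟨e, rfl, he⟩ := hline W hW hbot htop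
    rcases hroots e he with rfl | rfl
    exacts [.inl rfl, .inr rfl]

/-- An irreducible representation is irreducible on some two-generator subgroup. -/
theorem exists_isIrreducibleRep_closure_pair (ρ : RepPoints G) (hρ : IsIrreducibleRep ρ) :
    ∃ g h, IsIrreducibleRep (ρ.comp (Subgroup.closure {g, h}).subtype) := by
  simp only [isIrreducibleRep_closure_pair_iff]
  by_contra! hcon
  by_cases hs : ∀ g, ∃ c : ℂ, (ρ g).1 = c • 1
  · obtain ⟨W, -, -, hbot, htop⟩ :=
      exists_invariant_of_commute (a := 1) (b := 1) rfl
    refine (hρ W fun g w hw => ?_).elim hbot htop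
    obtain ⟨c, hc⟩ := hs g
    rw [hc, Matrix.smul_mulVec, Matrix.one_mulVec]
    exact W.smul_mem c hw
  · push Not at hs
    obtain ⟨g, hg⟩ := hs
    obtain ⟨W₁, W₂, ⟨hb₁, ht₁⟩, ⟨hb₂, ht₂⟩, hW⟩ := exists_two_invariant (ρ g).1 (by simpa using hg)
    -- If every pair `g, h` is reducible, the group is the union of the stabilizers of `W₁` and
    -- `W₂`. Both are proper by irreducibility of `ρ`; the product of an element outside one and an
    -- element outside the other gives the contradiction.
    have hpair : ∀ h, (∀ w ∈ W₁, (ρ h).1.mulVec w ∈ W₁) ∨ (∀ w ∈ W₂, (ρ h).1.mulVec w ∈ W₂) := by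
      intro h
      obtain ⟨W, h1, h2, h3, h4⟩ := hcon g h
      rcases hW W h1 h3 h4 with rfl | rfl
      exacts [.inl h2, .inr h2]
    have hne : ∀ W : Submodule ℂ (Fin 2 → ℂ), W ≠ ⊥ → W ≠ ⊤ →
        ∃ h, ¬ ∀ w ∈ W, (ρ h).1.mulVec w ∈ W := fun W hb ht => by
      by_contra! h
      exact (hρ W h).elim hb ht
    obtain ⟨h, hh⟩ := hne W₁ hb₁ ht₁
    obtain ⟨k, hk⟩ := hne W₂ hb₂ ht₂
    have hh₂ := (hpair h).resolve_left hh
    have hk₁ := (hpair k).resolve_right hk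
    rcases hpair (h * k) with h1 | h1
    · refine hh fun w hw => ?_
      have := h1 _ (mulVec_inv_mem _ hk₁ w hw)
      rwa [Matrix.mulVec_mulVec, ← Matrix.SpecialLinearGroup.coe_mul, map_mul, mul_assoc,
        mul_inv_cancel, mul_one] at this
    · refine hk fun w hw => ?_
      have := mulVec_inv_mem _ hh₂ _ (h1 w hw)
      rwa [Matrix.mulVec_mulVec, ← Matrix.SpecialLinearGroup.coe_mul, map_mul,
        inv_mul_cancel_left] at this

end Irreducibility

/-! ### Orders in `M₂` spanned by four matrices with nondegenerate trace form -/

section Orders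

/-- `G` is the Gram matrix, for the trace form, of the matrices `e i`. -/
def IsTraceGram {R F : Type*} [CommRing R] [Field F] [Algebra R F]
    (e : Fin 4 → Matrix (Fin 2) (Fin 2) F) (G : Matrix (Fin 4) (Fin 4) R) : Prop :=
  ∀ i j, algebraMap R F (G i j) = (e i * e j).trace

namespace IsTraceGram

variable {R F : Type*} [CommRing R] [Field F] [Algebra R F]
  {e : Fin 4 → Matrix (Fin 2) (Fin 2) F} {G : Matrix (Fin 4) (Fin 4) R}

/-- The basis of `M₂(F)` given by matrices with nondegenerate trace form. -/
def basis (hG : IsTraceGram e G) (hu : IsUnit G.det) :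
    Module.Basis (Fin 4) F (Matrix (Fin 2) (Fin 2) F) :=
  basisOfLinearIndependentOfCardEqFinrank (b := e) (by
    rw [Fintype.linearIndependent_iff]
    intro c hc
    have h0 : (G.map (algebraMap R F)).mulVec c = 0 := by
      ext i
      have := congrArg (fun Y => (e i * Y).trace) hc
      simp only [Finset.mul_sum, Matrix.trace_sum, Matrix.mul_smul, Matrix.trace_smul, mul_zero,
        Matrix.trace_zero, smul_eq_mul] at this
      rw [Matrix.mulVec, dotProduct, Pi.zero_apply, ← this]
      exact Finset.sum_congr rfl fun j _ => by rw [Matrix.map_apply, hG, mul_comm]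
    have hu' : (G.map (algebraMap R F)).det ≠ 0 := by
      have := hu.map (algebraMap R F)
      rw [RingHom.map_det] at this
      exact this.ne_zero
    exact congrFun (Matrix.eq_zero_of_mulVec_eq_zero hu' h0))
    (by simp [Module.finrank_matrix])

@[simp]
theorem basis_apply (hG : IsTraceGram e G) (hu : IsUnit G.det) (i : Fin 4) :
    hG.basis hu i = e i := by
  simp [basis]

/-- The dual family of `e` for the trace form. -/
def dual (e : Fin 4 → Matrix (Fin 2) (Fin 2) F) (G : Matrix (Fin 4) (Fin 4) R) (j : Fin 4) :
    Matrix (Fin 2) (Fin 2) F :=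
  ∑ i, G⁻¹ j i • e i

theorem trace_dual_mul (hG : IsTraceGram e G) (hu : IsUnit G.det) (j k : Fin 4) :
    (dual e G j * e k).trace = if j = k then 1 else 0 := by
  have : (dual e G j * e k).trace = algebraMap R F ((G⁻¹ * G) j k) := by
    rw [Matrix.mul_apply, map_sum, dual, Finset.sum_mul, Matrix.trace_sum]
    refine Finset.sum_congr rfl fun i _ => ?_
    rw [map_mul, hG, Matrix.smul_mul, Matrix.trace_smul, Algebra.smul_def]
  rw [this, Matrix.nonsing_inv_mul _ hu, Matrix.one_apply]
  split_ifs <;> simp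

/-- Expansion of a matrix in the basis `e`. -/
theorem sum_trace_dual_smul (hG : IsTraceGram e G) (hu : IsUnit G.det)
    (Y : Matrix (Fin 2) (Fin 2) F) : ∑ j, (dual e G j * Y).trace • e j = Y := by
  let f : Matrix (Fin 2) (Fin 2) F →ₗ[F] Matrix (Fin 2) (Fin 2) F :=
    ∑ j, LinearMap.smulRight ((Matrix.traceLinearMap (Fin 2) F F).comp
      (LinearMap.mulLeft F (dual e G j))) (e j)
  have h : f = LinearMap.id := (hG.basis hu).ext fun k => by
    simp [f, hG.trace_dual_mul hu]
  simpa [f] using LinearMap.congr_fun h Y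

/-- The Casimir identity. -/
theorem sum_mul_mul_dual (hG : IsTraceGram e G) (hu : IsUnit G.det)
    (Y : Matrix (Fin 2) (Fin 2) F) : ∑ j, e j * Y * dual e G j = Y.trace • 1 := by
  -- The expansion in the basis `e`, applied to the matrix unit at `(l, n)` and read at the entry
  -- `(k, m)`. The Casimir identity is this relation contracted with `Y`.
  have key : ∀ k m n l, ∑ j, e j k m * dual e G j n l =
      if k = l ∧ n = m then 1 else 0 := by
    intro k m n l
    have := congrFun (congrFun (hG.sum_trace_dual_smul hu (Matrix.single l n 1)) k) m
    rw [Matrix.sum_apply] at this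
    simp only [Matrix.trace_mul_single, Matrix.smul_apply, smul_eq_mul] at this
    rw [Matrix.single_apply] at this
    simpa [mul_comm, eq_comm] using this
  ext k l
  have : (∑ j, e j * Y * dual e G j) k l =
      ∑ n, ∑ m, Y m n * ∑ j, e j k m * dual e G j n l := by
    simp only [Matrix.sum_apply, Matrix.mul_apply, Finset.sum_mul, Finset.mul_sum]
    rw [Finset.sum_comm]
    refine Finset.sum_congr rfl fun n _ => ?_
    rw [Finset.sum_comm]
    exact Finset.sum_congr rfl fun m _ => Finset.sum_congr rfl fun j _ => by ring
  rw [this]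
  simp only [key, Matrix.smul_apply, Matrix.one_apply, Matrix.trace_fin_two, Fin.sum_univ_two]
  fin_cases k <;> fin_cases l <;> simp

/-- A matrix whose products with the `e i` have traces in `R` lies in the `R`-span of the `e i`. -/
theorem mem_span (hG : IsTraceGram e G) (hu : IsUnit G.det) {Y : Matrix (Fin 2) (Fin 2) F}
    (hY : ∀ i, (e i * Y).trace ∈ (algebraMap R F).range) :
    Y ∈ Submodule.span R (Set.range e) := by
  rw [← hG.sum_trace_dual_smul hu Y]
  refine Submodule.sum_mem _ fun j _ => ?_
  have : (dual e G j * Y).trace ∈ (algebraMap R F).range := by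
    rw [dual, Finset.sum_mul, Matrix.trace_sum]
    refine Subring.sum_mem _ fun i _ => ?_
    rw [Matrix.smul_mul, Matrix.trace_smul, Algebra.smul_def]
    exact Subring.mul_mem _ ⟨_, rfl⟩ (hY i)
  obtain ⟨r, hr⟩ := this
  rw [← hr, algebraMap_smul]
  exact Submodule.smul_mem _ _ (Submodule.subset_span ⟨j, rfl⟩)

variable [FaithfulSMul R F] {Λ : Subalgebra R (Matrix (Fin 2) (Fin 2) F)}

theorem linearIndependent (hG : IsTraceGram e G) (hu : IsUnit G.det) : LinearIndependent R e := by
  have := (hG.basis hu).linearIndependent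
  have he : ⇑(hG.basis hu) = e := funext (hG.basis_apply hu)
  rw [he] at this
  exact this.restrict_scalars' R

/-- The `R`-basis `e` of the order spanned by `e`. -/
def orderBasis (hG : IsTraceGram e G) (hu : IsUnit G.det)
    (hΛ : Subalgebra.toSubmodule Λ = Submodule.span R (Set.range e)) : Module.Basis (Fin 4) R Λ :=
  (Module.Basis.span (hG.linearIndependent hu)).map (LinearEquiv.ofEq _ _ hΛ.symm)

@[simp]
theorem orderBasis_apply (hG : IsTraceGram e G) (hu : IsUnit G.det)
    (hΛ : Subalgebra.toSubmodule Λ = Submodule.span R (Set.range e)) (i : Fin 4) :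
    (hG.orderBasis hu hΛ i : Matrix (Fin 2) (Fin 2) F) = e i := by
  rw [orderBasis, Module.Basis.map_apply]
  exact congrArg Subtype.val (Module.Basis.span_apply (hG.linearIndependent hu) i)

/-- An order spanned by four matrices with unimodular trace form is an Azumaya algebra. -/
theorem isAzumaya (hG : IsTraceGram e G) (hu : IsUnit G.det)
    (hΛ : Subalgebra.toSubmodule Λ = Submodule.span R (Set.range e)) : IsAzumaya R Λ := by
  have hRF : Function.Injective (algebraMap R F) := FaithfulSMul.algebraMap_injective R F
  have : Nontrivial R := (algebraMap R F).domain_nontrivial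
  let b := hG.orderBasis hu hΛ
  have hfree : Module.Free R Λ := .of_basis b
  have hfin : Module.Finite R Λ := .of_basis b
  have hfinop : Module.Finite R Λᵐᵒᵖ := .equiv (MulOpposite.opLinearEquiv R)
  have hfreeop : Module.Free R Λᵐᵒᵖ := .of_equiv (MulOpposite.opLinearEquiv R)
  have hmem : ∀ i, e i ∈ Λ := fun i => by
    rw [← Subalgebra.mem_toSubmodule, hΛ]
    exact Submodule.subset_span ⟨i, rfl⟩
  have hdual : ∀ j, dual e G j ∈ Λ := fun j =>
    Λ.sum_mem fun i _ => Λ.smul_mem (hmem i) _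
  have hfaith : FaithfulSMul R Λ := ⟨fun {r s} h => hRF (by
    have := congrArg Subtype.val (h 1)
    have := congrFun (congrFun this 0) 0
    simpa [Algebra.smul_def, Matrix.algebraMap_matrix_apply] using this)⟩
  refine { bij := ?_ }
  -- `Λ ⊗ Λᵐᵒᵖ` and `End Λ` are both free of rank 16, so surjectivity is enough.
  refine OrzechProperty.bijective_of_surjective_of_finrank_le
    (AlgHom.mulLeftRight R Λ).toLinearMap ?_ ?_
  · rw [← LinearMap.range_eq_top, eq_top_iff, ← (b.linearMap b).span_eq, Submodule.span_le]
    rintro _ ⟨⟨k, j⟩, rfl⟩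
    -- Preimage of the elementary endomorphism taking `e j` to `e k`: with `e*` the dual family, the
    -- Casimir identity gives `∑ i, e i * z * e* j * e* i * e k = tr (z * e* j) • e k`.
    refine ⟨∑ i, (⟨e i, hmem i⟩ : Λ) ⊗ₜ
      MulOpposite.op (⟨dual e G j, hdual j⟩ * ⟨dual e G i, hdual i⟩ * ⟨e k, hmem k⟩ : Λ), ?_⟩
    refine b.ext fun l => Subtype.ext ?_
    rw [Module.Basis.linearMap_apply_apply]
    have hcas := hG.sum_mul_mul_dual hu (e l * dual e G j)
    rw [Matrix.trace_mul_comm, hG.trace_dual_mul hu] at hcas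
    have hsum : (∑ i, e i * (e l * (dual e G j * dual e G i * e k))) =
        (∑ i, e i * (e l * dual e G j) * dual e G i) * e k := by
      rw [Finset.sum_mul]
      exact Finset.sum_congr rfl fun i _ => by simp only [mul_assoc]
    have hl : (b l : Matrix (Fin 2) (Fin 2) F) = e l := hG.orderBasis_apply hu hΛ l
    simp only [AlgHom.toLinearMap_apply, map_sum, LinearMap.sum_apply,
      AlgHom.mulLeftRight_apply, MulOpposite.unop_op, AddSubmonoidClass.coe_finsetSum,
      MulMemClass.coe_mul, hl, mul_assoc (e _) (e l), hsum, hcas]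
    split_ifs
    · simp [b]
    · simp
  · rw [Module.finrank_tensorProduct, Module.finrank_eq_card_basis (b.linearMap b),
      Module.finrank_eq_card_basis b, Module.finrank_eq_card_basis
        (b.map (MulOpposite.opLinearEquiv R)), Fintype.card_prod]

/-- The base change of an order spanned by `e` is the algebra spanned by `e`. -/
theorem nonempty_baseChange_algEquiv {K : Type*} [Field K] [Algebra K F] [Algebra R K]
    [IsScalarTower R K F] (hG : IsTraceGram e G) (hu : IsUnit G.det)
    (hΛ : Subalgebra.toSubmodule Λ = Submodule.span R (Set.range e))
    {A : Subalgebra K (Matrix (Fin 2) (Fin 2) F)}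
    (hA : Subalgebra.toSubmodule A = Submodule.span K (Set.range e)) :
    Nonempty (K ⊗[R] Λ ≃ₐ[K] A) := by
  have hG' : IsTraceGram e (G.map (algebraMap R K)) := fun i j => by
    rw [Matrix.map_apply, ← IsScalarTower.algebraMap_apply, hG]
  have hu' : IsUnit (G.map (algebraMap R K)).det := by
    have := hu.map (algebraMap R K)
    rwa [RingHom.map_det] at this
  have hle : ∀ a : Λ, (a : Matrix (Fin 2) (Fin 2) F) ∈ A := fun a => by
    rw [← Subalgebra.mem_toSubmodule, hA]
    have ha := a.2
    rw [← Subalgebra.mem_toSubmodule, hΛ] at ha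
    exact Submodule.span_le_restrictScalars R K _ ha
  let φ : Λ →ₐ[R] A :=
    { toFun := fun a => ⟨a, hle a⟩
      map_one' := rfl
      map_mul' := fun _ _ => rfl
      map_zero' := rfl
      map_add' := fun _ _ => rfl
      commutes' := fun _ => rfl }
  let f : K ⊗[R] Λ →ₐ[K] A := Algebra.TensorProduct.lift (Algebra.ofId K A) φ
    fun c a => Algebra.commutes c (φ a)
  let b := Algebra.TensorProduct.basis K (hG.orderBasis hu hΛ)
  let b' := hG'.orderBasis hu' hA
  -- The Gram determinant stays a unit in `K`, so the `e i` form a `K`-basis of `A`; the natural map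
  -- carries the basis `1 ⊗ e i` to it.
  have hf : f.toLinearMap = (b.equiv b' (Equiv.refl _)).toLinearMap := by
    refine b.ext fun i => Subtype.ext ?_
    have h1 : f (b i) = φ (hG.orderBasis hu hΛ i) := by
      rw [Algebra.TensorProduct.basis_apply]
      exact (Algebra.TensorProduct.lift_tmul _ _ _ _ _).trans (by rw [map_one, one_mul])
    have h2 : b.equiv b' (Equiv.refl _) (b i) = b' i := Module.Basis.equiv_apply _ _ _ _
    rw [AlgHom.toLinearMap_apply, LinearEquiv.coe_coe, h1, h2, orderBasis_apply]
    exact hG.orderBasis_apply hu hΛ i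
  refine ⟨AlgEquiv.ofBijective f ?_⟩
  have : ⇑f = b.equiv b' (Equiv.refl _) := congrArg DFunLike.coe hf
  rw [this]
  exact LinearEquiv.bijective _

end IsTraceGram

/-- The Gram matrix of `1, a, b, ab` for `a, b` of determinant `1` and with traces `s, t, u` of `a`,
`b` and `ab`. -/
def pairGram {R : Type*} [CommRing R] (s t u : R) : Matrix (Fin 4) (Fin 4) R :=
  !![2, s, t, u;
     s, s ^ 2 - 2, u, s * u - t;
     t, u, t ^ 2 - 2, t * u - s;
     u, s * u - t, t * u - s, u ^ 2 - 2]

/-- The discriminant of the span of `1, a, b, ab`: the trace form is unimodular as soon as `tr [a,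
b] - 2` is a unit. -/
theorem det_pairGram {R : Type*} [CommRing R] (s t u : R) :
    (pairGram s t u).det = -commTrace s t u ^ 2 := by
  simp [pairGram, Matrix.det_succ_row_zero, Fin.sum_univ_succ, Fin.succAbove, commTrace]
  ring

theorem trace_mul_self {F : Type*} [CommRing F] {a : Matrix (Fin 2) (Fin 2) F} (ha : a.det = 1) :
    (a * a).trace = a.trace ^ 2 - 2 := by
  rw [Matrix.det_fin_two] at ha
  simp only [Matrix.trace_fin_two, Matrix.mul_apply, Fin.sum_univ_two]
  linear_combination -2 * ha

/-- Multiply the Cayley–Hamilton relation `a² = tr(a) a - 1` by `b` and take traces. Such relations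
make all sixteen Gram entries polynomials in `s, t, u`. -/
theorem trace_mul_mul_self {F : Type*} [CommRing F] {a : Matrix (Fin 2) (Fin 2) F}
    (ha : a.det = 1) (b : Matrix (Fin 2) (Fin 2) F) :
    (a * (a * b)).trace = a.trace * (a * b).trace - b.trace := by
  rw [Matrix.det_fin_two] at ha
  simp only [Matrix.trace_fin_two, Matrix.mul_apply, Fin.sum_univ_two]
  linear_combination -(b 0 0 + b 1 1) * ha

theorem isTraceGram_pairGram {R F : Type*} [CommRing R] [Field F] [Algebra R F]
    {a b : Matrix (Fin 2) (Fin 2) F} (ha : a.det = 1) (hb : b.det = 1) {s t u : R}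
    (hs : algebraMap R F s = a.trace) (ht : algebraMap R F t = b.trace)
    (hu : algebraMap R F u = (a * b).trace) : IsTraceGram ![1, a, b, a * b] (pairGram s t u) := by
  have hu' : algebraMap R F u = (b * a).trace := hu.trans (Matrix.trace_mul_comm _ _)
  have hab : (a * b).det = 1 := by rw [Matrix.det_mul, ha, hb, one_mul]
  have h1 := trace_mul_self ha
  have h2 := trace_mul_self hb
  have h3 := trace_mul_self hab
  have h4 := trace_mul_mul_self ha b
  have h5 : (a * b * a).trace = a.trace * (a * b).trace - b.trace := by
    rw [Matrix.trace_mul_comm, h4]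
  have h6 : (a * b * b).trace = b.trace * (a * b).trace - a.trace := by
    rw [Matrix.mul_assoc, Matrix.trace_mul_comm, Matrix.mul_assoc, trace_mul_mul_self hb,
      Matrix.trace_mul_comm b a]
  have h7 : (b * (a * b)).trace = b.trace * (a * b).trace - a.trace := by
    rw [Matrix.trace_mul_comm, h6]
  intro i j
  fin_cases i <;> fin_cases j <;>
    simp only [pairGram, Fin.isValue, Fin.zero_eta, Fin.mk_one, Fin.reduceFinMk, Matrix.of_apply,
      Matrix.cons_val, Matrix.cons_val_zero, Matrix.cons_val_one, map_sub, map_mul, map_pow,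
      map_ofNat, one_mul, mul_one, h1, h2, h3, h4, h5, h6, h7, hs, ht, hu]
  · simp
  · exact Matrix.trace_mul_comm _ _

/-- Let `P` be a representation in `SL₂(F)` with traces in `R`, and let the commutator of `g` and
`h` have trace different from `2` modulo every maximal ideal. Then `P` takes values in the
`R`-span of `1, P(g), P(h), P(gh)`. -/
theorem adjoin_range_eq_span {R F H : Type*} [CommRing R] [Field F] [Algebra R F] [Group H]
    (P : H →* Matrix.SpecialLinearGroup (Fin 2) F)
    (hP : ∀ k, (P k).1.trace ∈ (algebraMap R F).range) {g h : H} {s t u : R}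
    (hs : algebraMap R F s = (P g).1.trace) (ht : algebraMap R F t = (P h).1.trace)
    (hu : algebraMap R F u = (P (g * h)).1.trace) (hunit : IsUnit (commTrace s t u)) :
    Subalgebra.toSubmodule (Algebra.adjoin R (Set.range fun k => (P k).1)) =
      Submodule.span R (Set.range ![1, (P g).1, (P h).1, (P g).1 * (P h).1]) := by
  have hclosure : (Submonoid.closure (Set.range fun k => (P k).1) : Set _) =
      Set.range fun k => (P k).1 := by
    refine Set.Subset.antisymm (fun a ha => ?_) Submonoid.subset_closure
    induction ha using Submonoid.closure_induction with
    | mem a ha => exact ha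
    | one => exact ⟨1, by simp⟩
    | mul a b _ _ ha hb =>
      obtain ⟨g, rfl⟩ := ha
      obtain ⟨k, rfl⟩ := hb
      exact ⟨g * k, by simp⟩
  rw [Algebra.adjoin_eq_span, hclosure]
  have he : ∀ i, ∃ k, ![1, (P g).1, (P h).1, (P g).1 * (P h).1] i = (P k).1 := by
    intro i
    fin_cases i
    exacts [⟨1, by simp⟩, ⟨g, rfl⟩, ⟨h, rfl⟩, ⟨g * h, by simp⟩]
  refine le_antisymm (Submodule.span_le.2 ?_) (Submodule.span_le.2 ?_)
  · rintro _ ⟨k, rfl⟩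
    -- Each of the four matrices is itself a value of `P`, so the traces needed for the dual basis
    -- expansion of `P k` are traces of group elements, hence in `R`.
    refine (isTraceGram_pairGram (P g).2 (P h).2 hs ht (by simpa using hu)).mem_span ?_ fun i => ?_
    · rw [det_pairGram]
      exact (hunit.pow 2).neg
    · obtain ⟨l, hl⟩ := he i
      rw [hl, ← Matrix.SpecialLinearGroup.coe_mul, ← map_mul]
      exact hP _
  · rintro _ ⟨i, rfl⟩
    obtain ⟨l, hl⟩ := he i
    rw [hl]
    exact Submodule.subset_span ⟨l, rfl⟩

end Orders

/-! ### Vertex stabilizers in the tree -/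

section Stabilizers

variable {F : Type*} [Field F] (O : ValuationSubring F)

/-- Endomorphisms that preserve a lattice have integral matrices in a suitable basis. -/
theorem OLattice.exists_basis [IsPrincipalIdealRing O] (L : OLattice O) :
    ∃ b : Module.Basis (Fin 2) F (Fin 2 → F), ∀ T : (Fin 2 → F) →ₗ[F] (Fin 2 → F),
      (∀ l ∈ L.1, T l ∈ L.1) →
      ∃ N : Matrix (Fin 2) (Fin 2) O, N.map (algebraMap O F) = LinearMap.toMatrix b b T := by
  obtain ⟨L, hL⟩ := L
  have hfin : Module.finrank O L = 2 := by
    rw [Submodule.IsLattice.finrank_of_pi (K := F), Fintype.card_fin]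
  let b₀ : Module.Basis (Fin 2) O L := Module.finBasisOfFinrankEq O L hfin
  let b := b₀.extendOfIsLattice F
  have hb : ∀ i, b i = (b₀ i : Fin 2 → F) := fun i => b₀.extendOfIsLattice_apply F i
  refine ⟨b, fun T hT => ⟨Matrix.of fun i j => b₀.repr ⟨T (b₀ j), hT _ (b₀ j).2⟩ i, ?_⟩⟩
  ext i j
  rw [LinearMap.toMatrix_apply, Matrix.map_apply, Matrix.of_apply, hb]
  have h := b₀.sum_repr ⟨T (b₀ j), hT _ (b₀ j).2⟩
  set d := b₀.repr ⟨T (b₀ j), hT _ (b₀ j).2⟩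
  have h' : ∑ k, algebraMap O F (d k) • b k = T (b₀ j) := by
    refine Eq.trans ?_ (congrArg Subtype.val h)
    simp only [AddSubmonoidClass.coe_finsetSum, Submodule.coe_smul, algebraMap_smul, hb]
  rw [← h', Module.Basis.repr_sum_self]

/-- An instance of valuation rings being integrally closed; it bounds the homothety factor of a
lattice from its square, which is a determinant. -/
theorem mem_of_sq_mem {c : F} (h : c ^ 2 ∈ O) : c ∈ O := by
  rcases O.mem_or_inv_mem c with hc | hc
  · exact hc
  · by_cases h0 : c = 0
    · rw [h0]
      exact O.zero_mem
    · have := O.mul_mem _ _ h hc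
      rwa [pow_two, mul_assoc, mul_inv_cancel₀ h0, mul_one] at this

/-- An element of `SL₂(F)` that fixes a vertex of the tree is conjugate into `SL₂(O)`. -/
theorem exists_conj_of_act_eq [IsPrincipalIdealRing O] (g : Matrix.SpecialLinearGroup (Fin 2) F)
    (v : TreeVertex O) (h : TreeVertex.act O g v = v) :
    ∃ N : Matrix.SpecialLinearGroup (Fin 2) O, ∃ Q : Matrix.GeneralLinearGroup (Fin 2) F,
      N.1.map (algebraMap O F) = Q.1 * g.1 * (Q⁻¹).1 := by
  induction v using Quotient.inductionOn with | h L => ?_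
  obtain ⟨c, hc, hL⟩ := Quotient.exact h
  have hL' : ∀ l, l ∈ L.1 ↔ ∃ l' ∈ L.1, c • g.1.mulVec l' = l := by
    intro l
    rw [← SetLike.mem_coe, hL]
    constructor
    · rintro ⟨_, ⟨l', hl', rfl⟩, rfl⟩
      exact ⟨l', hl', rfl⟩
    · rintro ⟨l', hl', rfl⟩
      exact ⟨_, ⟨l', hl', rfl⟩, rfl⟩
  obtain ⟨b, hb⟩ := L.exists_basis O
  have hdet : ∀ T : (Fin 2 → F) →ₗ[F] (Fin 2 → F), (∀ l ∈ L.1, T l ∈ L.1) →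
      LinearMap.det T ∈ O := by
    intro T hT
    obtain ⟨N, hN⟩ := hb T hT
    rw [← LinearMap.det_toMatrix b, ← hN, ← RingHom.mapMatrix_apply, ← RingHom.map_det]
    exact N.det.2
  -- Here `L = c g L`, so `c⁻¹ g⁻¹` preserves `L` and its determinant `c⁻²` is integral. Then `g L =
  -- c⁻¹ L ⊆ L`, and since `det g = 1` this inclusion suffices for a matrix in `SL₂(O)`.
  have hcinv : c⁻¹ ∈ O := by
    refine mem_of_sq_mem O ?_
    have := hdet (c⁻¹ • (g⁻¹).1.mulVecLin) fun l hl => by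
      obtain ⟨l', hl', rfl⟩ := (hL' l).1 hl
      rw [LinearMap.smul_apply, Matrix.mulVecLin_apply, Matrix.mulVec_smul, Matrix.mulVec_mulVec,
        ← Matrix.SpecialLinearGroup.coe_mul, inv_mul_cancel, smul_smul, inv_mul_cancel₀ hc,
        Matrix.SpecialLinearGroup.coe_one, Matrix.one_mulVec, one_smul]
      exact hl'
    rwa [LinearMap.det_smul, Module.finrank_fin_fun, ← Matrix.toLin'_apply', LinearMap.det_toLin',
      (g⁻¹).2, mul_one] at this
  obtain ⟨N, hN⟩ := hb g.1.mulVecLin fun l hl => by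
    have h1 : c • g.1.mulVec l ∈ L.1 := (hL' _).2 ⟨l, hl, rfl⟩
    have h2 := L.1.smul_mem ⟨c⁻¹, hcinv⟩ h1
    have h3 : (⟨c⁻¹, hcinv⟩ : O) • c • g.1.mulVec l = g.1.mulVec l := by
      change c⁻¹ • c • g.1.mulVec l = _
      rw [smul_smul, inv_mul_cancel₀ hc, one_smul]
    rwa [h3] at h2
  have hNdet : N.det = 1 := by
    refine IsFractionRing.injective O F ?_
    rw [RingHom.map_det, RingHom.mapMatrix_apply, hN, LinearMap.det_toMatrix,
      ← Matrix.toLin'_apply', LinearMap.det_toLin', g.2, map_one]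
  refine ⟨⟨N, hNdet⟩, ⟨b.toMatrix (Pi.basisFun F (Fin 2)), (Pi.basisFun F (Fin 2)).toMatrix b,
    Module.Basis.toMatrix_mul_toMatrix_flip _ _, Module.Basis.toMatrix_mul_toMatrix_flip _ _⟩, ?_⟩
  have h4 : LinearMap.toMatrix (Pi.basisFun F (Fin 2)) (Pi.basisFun F (Fin 2)) g.1.mulVecLin =
      g.1 := by
    rw [← Matrix.toLin'_apply', ← Matrix.toLin_eq_toLin', LinearMap.toMatrix_toLin]
  have h5 := basis_toMatrix_mul_linearMap_toMatrix_mul_basis_toMatrix b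
    (Pi.basisFun F (Fin 2)) b (Pi.basisFun F (Fin 2)) g.1.mulVecLin
  rw [h4] at h5
  exact hN.trans h5.symm

end Stabilizers

/-! ### Open stars of vertices in the geometric realization of a graph -/

section Realization

variable {V : Type*} {G : SimpleGraph V}

theorem vertexPoint_self (u : V) : vertexPoint u u = 1 := by simp [vertexPoint]

theorem vertexPoint_of_ne {u v : V} (h : v ≠ u) : vertexPoint u v = 0 := by simp [vertexPoint, h]

/-- A point of the realization other than a midpoint lies in the open star of radius `1/2` of some
vertex. -/
theorem exists_half_lt {t : V → ℝ} (ht : t ∈ realization G) (hm : t ∉ midpoints G) :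
    ∃ v, 1 / 2 < t v := by
  obtain ⟨u, w, huw, a, b, ha, hb, hab, rfl⟩ := ht
  by_cases h : u = w
  · subst h
    refine ⟨u, ?_⟩
    simp only [Pi.add_apply, Pi.smul_apply, vertexPoint_self, smul_eq_mul]
    linarith
  have hadj := huw.resolve_left h
  rcases lt_trichotomy a b with hlt | heq | hlt
  · refine ⟨w, ?_⟩
    simp only [Pi.add_apply, Pi.smul_apply, vertexPoint_self, vertexPoint_of_ne (Ne.symm h),
      smul_eq_mul]
    linarith
  · refine (hm ⟨u, w, hadj, ?_⟩).elim
    have ha2 : a = 2⁻¹ := by linarith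
    rw [← heq, ha2, midpoint_eq_smul_add, smul_add, invOf_eq_inv]
  · refine ⟨u, ?_⟩
    simp only [Pi.add_apply, Pi.smul_apply, vertexPoint_self, vertexPoint_of_ne h,
      smul_eq_mul]
    linarith

/-- The barycentric coordinates of a point at two distinct vertices sum to at most `1`. -/
theorem eq_of_half_lt {t : V → ℝ} (ht : t ∈ realization G) {v v' : V} (hv : 1 / 2 < t v)
    (hv' : 1 / 2 < t v') : v = v' := by
  obtain ⟨u, w, -, a, b, ha, hb, hab, rfl⟩ := ht
  by_contra hne
  simp only [Pi.add_apply, Pi.smul_apply, smul_eq_mul] at hv hv'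
  have h1 : ∀ u : V, vertexPoint u v + vertexPoint u v' ≤ 1 := by
    intro u
    by_cases h : v = u
    · subst h
      rw [vertexPoint_self, vertexPoint_of_ne (Ne.symm hne), add_zero]
    · rw [vertexPoint_of_ne h, zero_add]
      by_cases h' : v' = u
      · rw [h', vertexPoint_self]
      · rw [vertexPoint_of_ne h']
        exact zero_le_one
  nlinarith [mul_le_mul_of_nonneg_left (h1 u) ha, mul_le_mul_of_nonneg_left (h1 w) hb]

/-- A path in the realization that avoids the midpoints stays in the open star of one vertex. -/
theorem exists_forall_half_lt {X : Type*} [TopologicalSpace X] [ConnectedSpace X] {f : X → V → ℝ}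
    (hf : Continuous f) (hr : ∀ q, f q ∈ realization G) (hm : ∀ q, f q ∉ midpoints G) :
    ∃ v, ∀ q, 1 / 2 < f q v := by
  obtain ⟨q₀⟩ := (inferInstance : Nonempty X)
  obtain ⟨v, hv⟩ := exists_half_lt (hr q₀) (hm q₀)
  have hopen : ∀ w, IsOpen {q | 1 / 2 < f q w} := fun w =>
    isOpen_lt continuous_const ((continuous_apply w).comp hf)
  -- Away from midpoints the open sets `1 / 2 < f q w`, for varying `w`, partition `X`, so each is
  -- also closed.
  have hclosed : IsClosed {q | 1 / 2 < f q v} := by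
    rw [← isOpen_compl_iff]
    have : {q | 1 / 2 < f q v}ᶜ = ⋃ w ∈ {w | w ≠ v}, {q | 1 / 2 < f q w} := by
      ext q
      simp only [Set.mem_compl_iff, Set.mem_ofPred_eq, Set.mem_iUnion, exists_prop]
      constructor
      · intro hq
        obtain ⟨w, hw⟩ := exists_half_lt (hr q) (hm q)
        exact ⟨w, fun h => hq (h ▸ hw), hw⟩
      · rintro ⟨w, hwv, hw⟩ hq
        exact hwv (eq_of_half_lt (hr q) hw hq)
    rw [this]
    exact isOpen_biUnion fun w _ => hopen w
  have := IsClopen.eq_univ ⟨hclosed, hopen v⟩ ⟨q₀, hv⟩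
  exact ⟨v, fun q => (this ▸ Set.mem_univ q : q ∈ {q | 1 / 2 < f q v})⟩

end Realization

/-! ### Pushing loops off the surface and lifting them to the universal cover -/

section Collar

variable {M : Type*} [TopologicalSpace M] [ChartedSpace (EuclideanHalfSpace 3) M]

/-- The complement of `S` can be pushed off the parallel copies of the components of `S`. -/
theorem exists_push [T2Space M] {S : Set M} (hS : IsCompact S)
    {c : C(S × Set.Icc (-1 : ℝ) 1, M)} (hc : IsBicollar S c) {T : S → Finset ℝ}
    (hT : IsLocallyConstant T) (hT1 : ∀ s, ∀ t ∈ T s, |t| < 1) :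
    ∃ H : C(I × (Sᶜ : Set M), M), (∀ m, H (0, m) = m) ∧
      ∀ m, H (1, m) ∉ parallelCopies S c T := by
  classical
  have : CompactSpace S := isCompact_iff_compactSpace.1 hS
  obtain ⟨hinj, hzero, hopen, -⟩ := hc
  -- A locally constant `T` on the compact `S` takes finitely many values, so all levels are bounded
  -- by one `r < 1`. The level `0` is inserted only to have a nonempty set to maximize over.
  obtain ⟨r, hr0, hr1, hr⟩ : ∃ r : ℝ, 0 ≤ r ∧ r < 1 ∧ ∀ s, ∀ t ∈ T s, |t| ≤ r := by
    have hfin : (⋃ A ∈ Set.range T, ((A : Set ℝ))).Finite :=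
      hT.range_finite.biUnion fun A _ => A.finite_toSet
    obtain ⟨r, hr, hmax⟩ := Set.exists_max_image _ (fun t : ℝ => |t|) (hfin.insert 0)
      (Set.insert_nonempty _ _)
    refine ⟨|r|, abs_nonneg r, ?_, fun s t ht => hmax t (.inr ?_)⟩
    · rcases hr with rfl | hr
      · simp
      · simp only [Set.mem_range, Set.iUnion_exists, Set.iUnion_iUnion_eq', Set.mem_iUnion] at hr
        obtain ⟨s, hs⟩ := hr
        exact hT1 s r hs
    · simp only [Set.mem_range, Set.iUnion_exists, Set.iUnion_iUnion_eq', Set.mem_iUnion]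
      exact ⟨s, ht⟩
  have hemb : Topology.IsClosedEmbedding c := c.continuous.isClosedEmbedding hinj
  let e := hemb.isEmbedding.toHomeomorph
  have hce : ∀ q, c (e.symm q) = q := fun q => congrArg Subtype.val (e.apply_symm_apply q)
  have hne : ∀ q : Set.range c, (q : M) ∉ S → ((e.symm q).2 : ℝ) ≠ 0 := by
    intro q hq h0
    refine hq ?_
    rw [← hce q]
    have : e.symm q = ((e.symm q).1, ⟨0, by norm_num⟩) := Prod.ext rfl (Subtype.ext h0)
    rw [this, hzero]
    exact (e.symm q).1.2
  -- the displacement of the collar coordinate at time `u`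
  let φ : ℝ → ℝ → ℝ := fun u t => (1 - u * r) * t + u * r * (t / |t|)
  -- For `t ≠ 0`, `φ u` keeps the sign of `t` and moves `|t|` towards `1`: it is the identity at `u
  -- = 0` and where `|t| = 1`, and it makes `|t|` exceed `r` at `u = 1`.
  have hφabs : ∀ u ∈ Set.Icc (0 : ℝ) 1, ∀ t ≠ 0, |φ u t| = (1 - u * r) * |t| + u * r := by
    intro u hu t ht
    have hur : 0 ≤ u * r := mul_nonneg hu.1 hr0
    have hur1 : u * r ≤ 1 := by nlinarith [hu.1, hu.2]
    have h : φ u t = ((1 - u * r) * |t| + u * r) * (t / |t|) := by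
      have : |t| ≠ 0 := abs_ne_zero.2 ht
      simp only [φ]
      field_simp
    rw [h, abs_mul, abs_div, abs_abs, div_self (abs_ne_zero.2 ht), mul_one, abs_of_nonneg]
    have := abs_nonneg t
    nlinarith
  have hφmem : ∀ u ∈ Set.Icc (0 : ℝ) 1, ∀ t ∈ Set.Icc (-1 : ℝ) 1, t ≠ 0 →
      φ u t ∈ Set.Icc (-1 : ℝ) 1 := by
    intro u hu t ht h0
    rw [Set.mem_Icc, ← abs_le, hφabs u hu t h0]
    have h1 : |t| ≤ 1 := abs_le.2 ht
    have hur1 : u * r ≤ 1 := by nlinarith [hu.1, hu.2]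
    nlinarith
  let push : I × Set.range c → M := fun q =>
    c ((e.symm q.2).1, Set.projIcc (-1) 1 (by norm_num) (φ q.1 (e.symm q.2).2))
  let F : I × (Sᶜ : Set M) → M := fun q =>
    if h : (q.2 : M) ∈ Set.range c then push (q.1, ⟨q.2, h⟩) else q.2
  have hF : Continuous F := by
    -- Gluing along two closed sets: on their overlap the collar coordinate is `±1`, where the push
    -- does nothing. The jump of `t / |t|` at `0` is on `S`, outside the domain.
    let A : Set (I × (Sᶜ : Set M)) := {q | (q.2 : M) ∈ Set.range c}
    let B : Set (I × (Sᶜ : Set M)) := {q | (q.2 : M) ∉ c '' {p | |(p.2 : ℝ)| < 1}}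
    have hA : IsClosed A :=
      hemb.isClosed_range.preimage (continuous_subtype_val.comp continuous_snd)
    have hB : IsClosed B := by
      have := hopen.preimage (continuous_subtype_val.comp continuous_snd :
        Continuous fun q : I × (Sᶜ : Set M) => (q.2 : M))
      exact this.isClosed_compl
    have hAB : A ∪ B = Set.univ := by
      refine Set.eq_univ_of_forall fun q => ?_
      by_cases h : (q.2 : M) ∈ Set.range c
      · exact .inl h
      · exact .inr fun ⟨s, _, hs⟩ => h ⟨s, hs⟩
    rw [← continuousOn_univ, ← hAB]
    refine ContinuousOn.union_of_isClosed ?_ ?_ hA hB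
    · rw [continuousOn_iff_continuous_domRestrict]
      have h1 : A.domRestrict F = fun q : A => push (q.1.1, ⟨q.1.2, q.2⟩) := by
        funext q
        exact dif_pos q.2
      rw [h1]
      have h2 : Continuous fun q : A => e.symm ⟨(q.1.2 : M), q.2⟩ :=
        e.symm.continuous.comp (Continuous.subtype_mk (continuous_subtype_val.comp
          (continuous_snd.comp continuous_subtype_val)) _)
      have h3 : Continuous fun q : A => ((e.symm ⟨(q.1.2 : M), q.2⟩).2 : ℝ) :=
        continuous_subtype_val.comp (continuous_snd.comp h2)
      have h4 : Continuous fun q : A => (q.1.1 : ℝ) :=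
        continuous_subtype_val.comp (continuous_fst.comp continuous_subtype_val)
      refine c.continuous.comp ((continuous_fst.comp h2).prodMk (continuous_projIcc.comp ?_))
      refine ((continuous_const.sub (h4.mul continuous_const)).mul h3).add
        ((h4.mul continuous_const).mul (h3.div (continuous_abs.comp h3) fun q => ?_))
      exact abs_ne_zero.2 (hne _ q.1.2.2)
    · refine (continuous_subtype_val.comp continuous_snd).continuousOn.congr fun q hq => ?_
      by_cases h : (q.2 : M) ∈ Set.range c
      · have h5 : F q = push (q.1, ⟨q.2, h⟩) := dif_pos h
        rw [h5]
        have h6 := hne ⟨q.2, h⟩ q.2.2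
        have h7 := hce ⟨q.2, h⟩
        have h8 : |((e.symm ⟨q.2, h⟩).2 : ℝ)| = 1 := by
          refine le_antisymm (abs_le.2 (e.symm ⟨q.2, h⟩).2.2) (not_lt.1 fun hlt => hq ?_)
          exact ⟨_, hlt, h7⟩
        have h9 : φ q.1 (e.symm ⟨q.2, h⟩).2 = (e.symm ⟨q.2, h⟩).2 := by
          simp only [φ, h8]
          ring
        change c ((e.symm _).1, Set.projIcc (-1) 1 _ (φ q.1 (e.symm ⟨q.2, h⟩).2)) = q.2
        rw [h9, Set.projIcc_val]
        exact h7
      · exact dif_neg h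
  refine ⟨⟨F, hF⟩, fun m => ?_, fun m hm => ?_⟩
  · by_cases h : (m : M) ∈ Set.range c
    · have h5 : F (0, m) = push (0, ⟨m, h⟩) := dif_pos h
      refine h5.trans ?_
      have h9 : φ (0 : I) (e.symm ⟨m, h⟩).2 = (e.symm ⟨m, h⟩).2 := by
        simp [φ]
      change c ((e.symm _).1, Set.projIcc (-1) 1 _ (φ (0 : I) (e.symm ⟨m, h⟩).2)) = m
      rw [h9, Set.projIcc_val]
      exact hce ⟨m, h⟩
    · exact dif_neg h
  · obtain ⟨s, t, ht, hst⟩ := hm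
    change F (1, m) = _ at hst
    by_cases h : (m : M) ∈ Set.range c
    · have h5 : F (1, m) = push (1, ⟨m, h⟩) := dif_pos h
      have h0 := hne ⟨m, h⟩ m.2
      have h6 := hinj (h5.symm.trans hst)
      have h7 := hφmem 1 (by norm_num) _ (e.symm ⟨m, h⟩).2.2 h0
      have h8 : φ 1 (e.symm ⟨m, h⟩).2 = t := by
        have := congrArg (fun q => (q.2 : ℝ)) h6
        simp only at this
        rw [← this]
        change _ = ((Set.projIcc (-1) 1 _ (φ (1 : I) (e.symm ⟨m, h⟩).2) : Set.Icc (-1 : ℝ) 1) : ℝ)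
        rw [Set.Icc.coe_one, Set.projIcc_of_mem _ h7]
      -- A level of `T` has absolute value at most `r`, but the pushed coordinate has absolute value
      -- `(1 - r)|t| + r > r`.
      have h9 := hr s t ht
      rw [← h8, hφabs 1 (by norm_num) _ h0] at h9
      have := abs_pos.2 h0
      nlinarith
    · refine h ⟨(s, t), ?_⟩
      rw [← hst]
      exact dif_neg h

/-- A loop in the complement of a detected surface fixes a vertex of the tree. -/
theorem exists_act_eq_of_loop {E F : Type*} [TopologicalSpace E] [Field F] {O : ValuationSubring F}
    [T2Space M] {p : C(E, M)} (hp : IsCoveringMap p) {e₀ : E}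
    {ρ : FundamentalGroup M (p e₀) →* Matrix.SpecialLinearGroup (Fin 2) F} {S : Set M}
    (hS : IsDetected O p e₀ ρ S) (γ : Path (p e₀) (p e₀)) (hγ : ∀ τ, γ τ ∉ S) :
    ∃ v, TreeVertex.act O (ρ (FundamentalGroup.fromPath (Path.Homotopic.Quotient.mk γ))) v = v := by
  obtain ⟨⟨⟨-, hScomp, -⟩, -⟩, c, T, f, hc, hT, hT1, hf, hfr, hequiv, hmid, -⟩ := hS
  obtain ⟨H, hH0, hH1⟩ := exists_push hScomp hc hT fun s => (hT1 s).2
  -- A free homotopy of `γ`: the base point moves, but both ends of the loop follow the same track.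
  let K : C(I × I, M) := H.comp ⟨fun q => (q.1, ⟨γ q.2, hγ q.2⟩), by fun_prop⟩
  have hK0 : ∀ τ, K (0, τ) = γ τ := fun τ => hH0 _
  let δ : C(I, E) := hp.liftPath γ e₀ γ.source
  have hδ : ∀ τ, p (δ τ) = γ τ := congrFun (hp.liftPath_lifts γ e₀ γ.source)
  have hδ0 : δ 0 = e₀ := hp.liftPath_zero γ e₀ γ.source
  have hKδ : ∀ τ, K (0, τ) = p (δ τ) := fun τ => (hK0 τ).trans (hδ τ).symm
  let L : C(I × I, E) := hp.liftHomotopy K δ hKδ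
  have hL : ∀ q, p (L q) = K q := congrFun (hp.liftHomotopy_lifts K δ hKδ)
  have hL0 : ∀ τ, L (0, τ) = δ τ := hp.liftHomotopy_zero K δ hKδ
  let α : Path e₀ (L (1, 0)) :=
    ⟨⟨fun u => L (u, 0), by fun_prop⟩, (hL0 0).trans hδ0, rfl⟩
  let δ' : Path e₀ (δ 1) := ⟨δ, hδ0, rfl⟩
  let β : Path (δ 1) (L (1, 1)) := ⟨⟨fun u => L (u, 1), by fun_prop⟩, hL0 1, rfl⟩
  have hK01 : ∀ u, K (u, 1) = K (u, 0) := fun u => by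
    simp only [K, ContinuousMap.comp_apply, ContinuousMap.coe_mk]
    congr 3
    rw [γ.source, γ.target]
  have hend : p (L (1, 1)) = p (L (1, 0)) := by rw [hL, hL, hK01]
  -- The pushed loop misses the parallel copies, so the image in the tree of its lift misses the
  -- midpoints and stays in the open star of one vertex `v`.
  obtain ⟨v, hv⟩ := exists_forall_half_lt (G := bassSerreTree O)
    (f := fun τ : I => f (L (1, τ))) (by fun_prop) (fun τ => hfr _) fun τ hτ => by
      rw [hmid, hL] at hτ
      exact hH1 _ hτ
  -- By equivariance, the coordinate of `f (L (1, 0))` at `ρ(γ) v` is that of `f (L (1, 1))` at `v`.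
  -- So `f (L (1, 0))` has coordinate above `1 / 2` at both `v` and `ρ(γ) v`, and the two coincide.
  refine ⟨v, eq_of_half_lt (hfr (L (1, 0))) ?_ (hv 0)⟩
  rw [← hequiv (FundamentalGroup.fromPath (Path.Homotopic.Quotient.mk γ)) (L (1, 0)) (L (1, 1))
    (Path.Homotopic.Quotient.mk α) (Path.Homotopic.Quotient.mk (δ'.trans β)) hend ?_ v]
  · exact hv 1
  · change Path.Homotopic.Quotient.mk ((δ'.trans β).map p.continuous) =
      Path.Homotopic.Quotient.mk ((γ.trans (α.map p.continuous)).cast rfl hend)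
    congr 1
    ext τ
    simp only [Path.map_coe, Function.comp_apply, Path.cast_coe, Path.trans_apply]
    split_ifs
    · exact hδ _
    · exact (hL _).trans ((hK01 _).trans (hL _).symm)

end Collar

/-! ### Traces at the ideal point and the tautological extension -/

section Main

variable {Γ : Type*} [Group Γ] {C : AlgCurve (charRing Γ)}

/-- The trace function of `g` on `C`. -/
def AlgCurve.traceFun (C : AlgCurve (charRing Γ)) (g : Γ) : C.coordRing :=
  ⟨fun χ => χ.1.1 g, fun χ => χ.1 g, Algebra.subset_adjoin ⟨g, rfl⟩, rfl⟩

/-- The traces of the tautological representation are functions on `C`. -/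
theorem RepCurve.algebraMap_traceFun (D : RepCurve C) (g : Γ) :
    algebraMap C.FunctionField D.FunctionField
      (algebraMap C.coordRing C.FunctionField (C.traceFun g)) = (D.tautRep g).1.trace := by
  have h1 : algebraMap C.FunctionField D.FunctionField
      (algebraMap C.coordRing C.FunctionField (C.traceFun g)) =
      algebraMap D.toAlgCurve.coordRing D.FunctionField (D.pullback (C.traceFun g)) :=
    IsFractionRing.lift_algebraMap _ _
  have h2 : D.pullback (C.traceFun g) = (D.regularMatrix g).trace := by
    refine Subtype.ext (funext fun ρ => ?_)
    rw [Matrix.trace_fin_two]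
    exact Matrix.trace_fin_two _
  rw [h1, h2, Matrix.trace_fin_two, Matrix.trace_fin_two, map_add]
  rfl

/-- The inclusion of the constants in the local ring of a point. -/
def CurvePoint.constHom {K : Type*} [Field K] [Algebra ℂ K] (x : CurvePoint K) :
    ℂ →+* IsLocalRing.ResidueField x.localRing :=
  (IsLocalRing.residue x.localRing).comp ((algebraMap ℂ K).codRestrict x.localRing x.const_mem)

variable (D : RepCurve C) {x : CurvePoint C.FunctionField} {y : CurvePoint D.FunctionField}

variable {D} in
theorem RepCurve.PointLiesOver.mem_iff (hyx : D.PointLiesOver y x) (f : C.FunctionField) :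
    f ∈ x.localRing ↔ algebraMap C.FunctionField D.FunctionField f ∈ y.localRing := by
  rw [← hyx, ValuationSubring.mem_comap]

/-- The inclusion `𝒪ₓ ⊆ 𝒪_y` for a point `y` over `x`. -/
def RepCurve.localHom (hyx : D.PointLiesOver y x) : x.localRing →+* y.localRing :=
  ((algebraMap C.FunctionField D.FunctionField).comp x.localRing.subtype).codRestrict y.localRing
    fun r => (hyx.mem_iff r).1 r.2

/-- Since `𝒪ₓ = 𝒪_y ∩ k(C)`, an element of `𝒪ₓ` invertible in `𝒪_y` has its inverse in `𝒪ₓ`. -/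
theorem RepCurve.isUnit_of_residue_ne_zero (hyx : D.PointLiesOver y x) {r : x.localRing}
    (hr : IsLocalRing.residue y.localRing (D.localHom hyx r) ≠ 0) : IsUnit r := by
  have hu : IsUnit (D.localHom hyx r) := (IsLocalRing.residue_ne_zero_iff_isUnit _).1 hr
  have hr0 : (r : C.FunctionField) ≠ 0 := fun h => hr (by
    have : r = 0 := Subtype.ext h
    rw [this, map_zero, map_zero])
  have hinv : (r : C.FunctionField)⁻¹ ∈ x.localRing := by
    rw [hyx.mem_iff, map_inv₀]
    obtain ⟨s, hs⟩ := hu.exists_right_inv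
    have hs' : algebraMap C.FunctionField D.FunctionField r * s = 1 := congrArg Subtype.val hs
    rw [inv_eq_of_mul_eq_one_right hs']
    exact s.2
  exact IsUnit.of_mul_eq_one ⟨_, hinv⟩ (Subtype.ext (mul_inv_cancel₀ hr0))

/-- If `P(g)` fixes a vertex of the tree, its trace lies in `𝒪ₓ`, and reduces to the limiting
character. -/
theorem RepCurve.exists_trace_mem (hyx : D.PointLiesOver y x) (g : Γ)
    (hg : ∃ v, TreeVertex.act y.localRing (D.tautRep g) v = v) :
    ∃ r : x.localRing, algebraMap x.localRing D.FunctionField r = (D.tautRep g).1.trace ∧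
      IsLocalRing.residue y.localRing (D.localHom hyx r) = D.limitingCharacter y g := by
  have := y.isDVR
  obtain ⟨v, hv⟩ := hg
  obtain ⟨N, Q, hN⟩ := exists_conj_of_act_eq _ _ v hv
  have htr : algebraMap y.localRing D.FunctionField N.1.trace = (D.tautRep g).1.trace := by
    have h2 := congrArg Matrix.trace hN
    rw [Matrix.trace_mul_cycle, Units.inv_mul, one_mul] at h2
    rw [← h2, Matrix.trace_fin_two, Matrix.trace_fin_two, map_add]
    rfl
  rw [← D.algebraMap_traceFun] at htr
  have hmem : algebraMap C.coordRing C.FunctionField (C.traceFun g) ∈ x.localRing := by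
    rw [hyx.mem_iff, ← htr]
    exact N.1.trace.2
  refine ⟨⟨_, hmem⟩, D.algebraMap_traceFun g, ?_⟩
  rw [D.limitingCharacter_eq y g N Q hN]
  exact congrArg _ (Subtype.ext htr.symm)

/-- Let `H → Γ` be a homomorphism whose image acts on the tree by elliptic elements, with limiting
character that of a representation `ρ` in `SL₂(ℂ)`. If `ρ` is irreducible on `⟨g, h⟩`, then the
`𝒪ₓ`-span of `1, P(g), P(h), P(gh)` is an Azumaya algebra that extends `A_{k(C)}`. -/
theorem RepCurve.isTautologicalExtension {H : Type*} [Group H] (ι : H →* Γ)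
    (hyx : D.PointLiesOver y x)
    (hfix : ∀ k, ∃ v, TreeVertex.act y.localRing (D.tautRep (ι k)) v = v) (ρ : RepPoints H)
    (hlim : ∀ k, D.limitingCharacter y (ι k) = y.constResidue (character ρ k)) (g h : H)
    (hgh : IsIrreducibleRep (ρ.comp (Subgroup.closure {g, h}).subtype)) :
    D.IsTautologicalExtension x (ι g) (ι h) := by
  choose r hr hres using fun k => D.exists_trace_mem hyx (ι k) (hfix k)
  have hres' : ∀ k, IsLocalRing.residue y.localRing (D.localHom hyx (r k)) =
      y.constHom (character ρ k) := fun k => (hres k).trans (hlim k)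
  -- The residue is the image of a complex number that is nonzero by irreducibility, and `ℂ` embeds
  -- in the residue field.
  have hunit : IsUnit (commTrace (r g) (r h) (r (g * h))) := by
    refine D.isUnit_of_residue_ne_zero hyx ?_
    have : IsLocalRing.residue y.localRing (D.localHom hyx (commTrace (r g) (r h) (r (g * h)))) =
        y.constHom (commTrace (character ρ g) (character ρ h) (character ρ (g * h))) := by
      simp only [map_commTrace, hres']
    rw [this]
    exact (map_ne_zero _).2 (commTrace_ne_zero ρ g h hgh)
  have hG := isTraceGram_pairGram (D.tautRep (ι g)).2 (D.tautRep (ι h)).2 (hr g) (hr h)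
    ((hr (g * h)).trans (by rw [map_mul, map_mul]; rfl))
  have hdet : IsUnit (pairGram (r g) (r h) (r (g * h))).det := by
    rw [det_pairGram]
    exact (hunit.pow 2).neg
  -- The order over `𝒪ₓ` is generated by the image of `H` alone, where traces are known to be
  -- integral. Over `k(C)` the traces of all of `Γ` are available, so the same four matrices span
  -- `A_{k(C)}`.
  have hΛ := adjoin_range_eq_span (R := x.localRing) (D.tautRep.comp ι)
    (fun k => ⟨r k, hr k⟩) (hr g) (hr h) (hr (g * h)) hunit
  have hA : Subalgebra.toSubmodule D.canonicalAlgebra = _ :=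
    adjoin_range_eq_span (R := C.FunctionField) D.tautRep
    (fun k => ⟨_, D.algebraMap_traceFun k⟩) (hr g) (hr h) ((hr (g * h)).trans (by rw [map_mul]))
    (map_commTrace (algebraMap x.localRing C.FunctionField) _ _ _ ▸ hunit.map _)
  refine ⟨_, hΛ.trans ?_, hG.isAzumaya hdet hΛ, hG.nonempty_baseChange_algEquiv hdet hΛ hA⟩
  congr 1
  simp only [Matrix.range_cons, Matrix.range_empty, Set.union_empty, map_mul,
    Matrix.SpecialLinearGroup.coe_mul]
  rfl

end Main

end CullerShalen

end

open CullerShalen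

theorem mainTheorem3
    {M E : Type*} [TopologicalSpace M] [ChartedSpace (EuclideanHalfSpace 3) M]
    (hM : IsOneCuspedHyperbolic M)
    [TopologicalSpace E] [SimplyConnectedSpace E]
    (p : C(E, M)) (hp : IsCoveringMap p) (e₀ : E)
    (C : AlgCurve (charRing (FundamentalGroup M (p e₀))))
    (hC : IsNormCurve C (peripheralElements (p e₀)))
    (D : RepCurve C)
    (x : CurvePoint C.FunctionField) (hx : C.IsIdealPoint x)
    (y : CurvePoint D.FunctionField) (hyx : D.PointLiesOver y x)
    (S : Set M) (hS : IsDetected y.localRing p e₀ D.tautRep S)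
    (hm : p e₀ ∉ S)
    (ρ : RepPoints (FundamentalGroup (complementComponent S (p e₀))
      ⟨p e₀, mem_connectedComponentIn hm⟩))
    (hρ : IsIrreducibleRep ρ)
    (hlim : ∀ γ, D.limitingCharacter y (complementMap S (p e₀) hm γ) =
      y.constResidue (character ρ γ)) :
    D.TautologicallyExtends x ∧
    (∃ g h, IsIrreducibleRep (ρ.comp (Subgroup.closure {g, h}).subtype)) ∧
    ∀ g h, IsIrreducibleRep (ρ.comp (Subgroup.closure {g, h}).subtype) →
      g * h ≠ h * g ∧
      D.IsTautologicalExtension x (complementMap S (p e₀) hm g)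
        (complementMap S (p e₀) hm h) := by
  have : T2Space M := hM.2.2.1
  -- Each element may have its own fixed vertex: traces and limiting character are computed one
  -- element at a time, so no common fixed vertex is needed.
  have hfix : ∀ γ, ∃ v, TreeVertex.act y.localRing
      (D.tautRep (complementMap S (p e₀) hm γ)) v = v := by
    intro γ
    obtain ⟨γ, rfl⟩ := Path.Homotopic.Quotient.mk_surjective γ
    exact exists_act_eq_of_loop hp hS (γ.map (incl _).continuous) fun τ =>
      connectedComponentIn_subset _ _ (γ τ).2
  have hext := D.isTautologicalExtension (complementMap S (p e₀) hm) hyx hfix ρ hlim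
  obtain ⟨g, h, hgh⟩ := exists_isIrreducibleRep_closure_pair ρ hρ
  exact ⟨⟨_, _, hext g h hgh⟩, ⟨g, h, hgh⟩, fun g h hgh =>
    ⟨not_commute_of_isIrreducibleRep ρ g h hgh, hext g h hgh⟩⟩
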